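/- Let $\alpha>0$, $r\in\mathbb R$, let $p\ge 1$ be an integer, put $\lambda=r/\alpha$ and $$\beta_j=-\Big(\prod_{\substack{0\le m\le p\\ m\ne j}}\frac1{j-m}\Big)\sum_{\substack{0\le m\le p\\ m\ne j}}\ \prod_{\substack{0\le l\le p\\ l\ne m,j}}(\lambda-l)\quad(0\le j\le p),\qquad W_{p,r}(z)=(\beta_0+\beta_1z+\cdots+\beta_pz^p)^\alpha .$$ (a) The function $G_{p,r}(z)=z^{-\alpha}\,W_{p,r}(e^{-z})\,e^{rz}$ (principal powers), given for small $z\neq0$ with $\operatorname{Re}z\ge0$, extends to a function analytic at $z=0$, and this extension satisfies $G_{p,r}(z)=1+O(z^p)$ as $z\to0$. (b) Let $(w_k)_{k\ge0}$ be a real sequence with $\sum_k|w_k|<\infty$ whose generating function is $W_{p,r}$, that is, $\sum_{k\ge0}w_kx^k=W_{p,r}(x)$ for $0\le x<1$ (real power; this determines the $w_k$). Let $m,n$ be integers with $n-1<\alpha\le n<m$ and $p\le m$, and let $f\in C^{m+n+1}(\mathbb R)$ be real-valued with $f^{(k)}\in L_1(\mathbb R)$ for $0\le k\le m+n+1$.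 Then $(w_k)$ approximates the left and the right fractional derivative of $f$ with shift $r$ and order $p$ at every $x\in\mathbb R$: with $N=\lfloor\alpha\rfloor+1$, the Riemann–Liouville derivatives $$D^\alpha_{x-}f(x)=\frac1{\Gamma(N-\alpha)}\frac{d^N}{dx^N}\int_{-\infty}^x\frac{f(\eta)\,d\eta}{(x-\eta)^{\alpha+1-N}},\qquad D^\alpha_{x+}f(x)=\frac{(-1)^N}{\Gamma(N-\alpha)}\frac{d^N}{dx^N}\int_x^{\infty}\frac{f(\eta)\,d\eta}{(\eta-x)^{\alpha+1-N}}$$ exist (the integrals converge absolutely for every $x$ and are $N$ times continuously differentiable in $x$), the series below converge absolutely for every $h>0$, and, as $h\to0^+$, $$D^\alpha_{x\mp}f(x)=\frac1{h^\alpha}\sum_{k=0}^\infty w_k\,f\big(x\mp(k-r)h\big)+O(h^p).$$ -/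

import Mathlib

open Set Filter Topology MeasureTheory Asymptotics

noncomputable section

namespace Grunwald

/-- The coefficient `β_j` of order `p`, with `lam = r / α`:
`β_j = - (∏_{m ≠ j} 1 / (j - m)) * ∑_{m ≠ j} ∏_{l ≠ m, j} (lam - l)`, all indices in `{0, …, p}`. -/
def beta (lam : ℝ) (p j : ℕ) : ℝ :=
  -(∏ m ∈ (Finset.range (p + 1)).erase j, 1 / ((j : ℝ) - (m : ℝ))) *
    ∑ m ∈ (Finset.range (p + 1)).erase j,
      ∏ l ∈ ((Finset.range (p + 1)).erase j).erase m, (lam - (l : ℝ))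

/-- The polynomial `β_0 + β_1 z + ⋯ + β_p z ^ p` for derivative order `α` and shift `r`. -/
def basePoly (α r : ℝ) (p : ℕ) : Polynomial ℝ :=
  ∑ j ∈ Finset.range (p + 1), Polynomial.monomial j (beta (r / α) p j)

/-- The generating function `W_{p,r} = (β_0 + β_1 x + ⋯ + β_p x ^ p) ^ α` at real arguments
(for a natural number `α` this is the ordinary power, whatever the sign of the base). -/
def genW (α r : ℝ) (p : ℕ) (x : ℝ) : ℝ :=
  (basePoly α r p).eval x ^ α

/-- The same generating function at complex arguments, with the principal power. -/
def genWC (α r : ℝ) (p : ℕ) (z : ℂ) : ℂ :=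
  (Polynomial.aeval z (basePoly α r p)) ^ (α : ℂ)

/-- `G_{p,r}(z) = z ^ (-α) * W_{p,r}(exp (-z)) * exp (r z)`, with principal powers. -/
def symbolG (α r : ℝ) (p : ℕ) (z : ℂ) : ℂ :=
  1 / z ^ (α : ℂ) * genWC α r p (Complex.exp (-z)) * Complex.exp (r * z)

/-- The real sequence `w` has the generating function `W`, and its series is absolutely
convergent (on the closed unit disc). The values on `[0, 1)` determine `w`. -/
structure IsGeneratedBy (w : ℕ → ℝ) (W : ℝ → ℝ) : Prop where
  summable_abs : Summable fun k => |w k|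
  hasSum : ∀ x ∈ Ico (0 : ℝ) 1, HasSum (fun k => w k * x ^ k) (W x)

/-- The integer `[α] + 1` of the Riemann-Liouville definition. -/
def rlOrder (α : ℝ) : ℕ := ⌊α⌋₊ + 1

/-- `∫_{-∞}^x f(η) / (x - η) ^ (α + 1 - n) dη`, with `n = [α] + 1`. -/
def leftIntegral (α : ℝ) (f : ℝ → ℝ) (x : ℝ) : ℝ :=
  ∫ η in Iio x, f η / (x - η) ^ (α + 1 - (rlOrder α : ℝ))

/-- `∫_x^∞ f(η) / (η - x) ^ (α + 1 - n) dη`, with `n = [α] + 1`. -/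
def rightIntegral (α : ℝ) (f : ℝ → ℝ) (x : ℝ) : ℝ :=
  ∫ η in Ioi x, f η / (η - x) ^ (α + 1 - (rlOrder α : ℝ))

/-- The left Riemann-Liouville derivative of order `α` of `f` exists at `x` and equals `d`. -/
structure HasLeftRLDerivAt (α : ℝ) (f : ℝ → ℝ) (d x : ℝ) : Prop where
  integrable : ∀ y, IntegrableOn (fun η => f η / (y - η) ^ (α + 1 - (rlOrder α : ℝ))) (Iio y)
  contDiffAt : ContDiffAt ℝ (rlOrder α) (leftIntegral α f) x
  eq : d = 1 / Real.Gamma ((rlOrder α : ℝ) - α) *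
    iteratedDeriv (rlOrder α) (leftIntegral α f) x

/-- The right Riemann-Liouville derivative of order `α` of `f` exists at `x` and equals `d`. -/
structure HasRightRLDerivAt (α : ℝ) (f : ℝ → ℝ) (d x : ℝ) : Prop where
  integrable : ∀ y, IntegrableOn (fun η => f η / (η - y) ^ (α + 1 - (rlOrder α : ℝ))) (Ioi y)
  contDiffAt : ContDiffAt ℝ (rlOrder α) (rightIntegral α f) x
  eq : d = (-1) ^ rlOrder α / Real.Gamma ((rlOrder α : ℝ) - α) *
    iteratedDeriv (rlOrder α) (rightIntegral α f) x

/-- The left Grünwald type operator with shift `r`, weights `w` and step `h`. -/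
def leftDelta (w : ℕ → ℝ) (α r h : ℝ) (f : ℝ → ℝ) (x : ℝ) : ℝ :=
  1 / h ^ α * ∑' k : ℕ, w k * f (x - ((k : ℝ) - r) * h)

/-- The right Grünwald type operator with shift `r`, weights `w` and step `h`. -/
def rightDelta (w : ℕ → ℝ) (α r h : ℝ) (f : ℝ → ℝ) (x : ℝ) : ℝ :=
  1 / h ^ α * ∑' k : ℕ, w k * f (x + ((k : ℝ) - r) * h)

/-- The weights `w` approximate the left fractional derivative of `f` at `x` with shift `r` and
order `p`: the derivative exists, the series converge, and the error is `O(h ^ p)` as `h → 0+`. -/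
def ApproximatesLeft (w : ℕ → ℝ) (α r : ℝ) (p : ℕ) (f : ℝ → ℝ) (x : ℝ) : Prop :=
  (∀ h : ℝ, 0 < h → Summable fun k : ℕ => w k * f (x - ((k : ℝ) - r) * h)) ∧
  ∃ d : ℝ, HasLeftRLDerivAt α f d x ∧
    (fun h : ℝ => d - leftDelta w α r h f x) =O[𝓝[>] 0] fun h : ℝ => h ^ p

/-- The weights `w` approximate the right fractional derivative of `f` at `x` with shift `r` and
order `p`. -/
def ApproximatesRight (w : ℕ → ℝ) (α r : ℝ) (p : ℕ) (f : ℝ → ℝ) (x : ℝ) : Prop :=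
  (∀ h : ℝ, 0 < h → Summable fun k : ℕ => w k * f (x + ((k : ℝ) - r) * h)) ∧
  ∃ d : ℝ, HasRightRLDerivAt α f d x ∧
    (fun h : ℝ => d - rightDelta w α r h f x) =O[𝓝[>] 0] fun h : ℝ => h ^ p

end Grunwald

end

namespace Grunwald

/-! Write `P` for the base polynomial. The number `-β_j` is the derivative at `λ` of the `j`-th
Lagrange basis polynomial on the nodes `0, …, p`, so the `β_j` differentiate polynomials of degree
at most `p` exactly, up to sign. Tested on the powers of `λ - x`, this gives `exp (λz) P(exp (-z)) =
z + O(z^(p+1))` (`expSum_sub_isBigO`). Dividing by `z` and taking the power `α` yields part (a),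
because `λα = r` (`exists_analytic_symbol`).

For part (b) with `α < n`, put `s = 2πiξ`. On the Fourier side the left derivative is multiplication
by `s^α` (`hasLeftRLDerivAt_of_fourier`), and the difference operator is multiplication by `h^(-α)
(∑ w_k exp (-khs)) exp (rhs)` (`hasSum_left_shifts`). The two multipliers differ by at most `C h^p
|s|^(α+p)` on the whole imaginary axis: near the origin by part (a), transferred to the series by
the identity theorem and continuity up to the boundary, and away from the origin because the series
is bounded. The smoothness of `f` makes `|ξ|^(α+p)` times its transform integrable, so the error is
`O(h^p)`.

For `α = n` this argument breaks at both ends: the Fourier form of the Riemann-Liouville integral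
would need integrability with weight `|ξ|^(-1)` at the origin, and `α + p` may reach the limit `m +
n` of the available decay. There the weights are the coefficients of the polynomial `P^n`; their
moments about `r` of order below `n + p` vanish except the `n`-th, which is `n!`
(`sum_coeff_pow_mul_sub_pow`), and Taylor's formula suffices. The right derivative follows by
reflection. -/

/-! ### The coefficients `β_j` and the symbol near the origin -/

open Polynomial in
-- Differentiating the Lagrange interpolation formula of `Q` at `lam`: the product rule applied to
-- each basis polynomial produces the double expression that defines `-beta`.
lemma sum_beta_mul_eval (lam : ℝ) (p : ℕ) (Q : ℝ[X]) (hQ : Q.degree < ((p + 1 : ℕ) : WithBot ℕ)) :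
    ∑ j ∈ Finset.range (p + 1), beta lam p j * Q.eval (j : ℝ) = -(derivative Q).eval lam := by
  have hinj : Set.InjOn (fun j : ℕ => (j : ℝ)) (Finset.range (p + 1) : Set ℕ) :=
    fun a _ b _ h => Nat.cast_injective h
  have hdeg : Q.degree < ((Finset.range (p + 1)).card : WithBot ℕ) := by simpa using hQ
  conv_rhs => rw [Lagrange.eq_interpolate hinj hdeg, Lagrange.interpolate_apply]
  rw [derivative_sum, eval_finsetSum, ← Finset.sum_neg_distrib]
  refine Finset.sum_congr rfl fun j _ => ?_
  rw [derivative_C_mul, eval_mul, eval_C, Lagrange.basis, derivative_prod_finset, eval_finsetSum, beta,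
    Finset.mul_sum, Finset.sum_mul, Finset.mul_sum, ← Finset.sum_neg_distrib]
  refine Finset.sum_congr rfl fun m hm => ?_
  simp only [Lagrange.basisDivisor, eval_mul, eval_prod, derivative_mul, derivative_C,
    derivative_sub, derivative_X, eval_C, eval_sub, eval_X, eval_add, eval_zero, eval_one]
  rw [Finset.prod_mul_distrib, ← Finset.mul_prod_erase _ _ hm]
  simp only [one_div]
  ring

lemma sum_beta_mul_sub_pow (lam : ℝ) (p k : ℕ) (hk : k ≤ p) :
    ∑ j ∈ Finset.range (p + 1), beta lam p j * (lam - j) ^ k = if k = 1 then 1 else 0 := by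
  have h := sum_beta_mul_eval lam p ((Polynomial.C lam - Polynomial.X) ^ k) (by
    refine lt_of_le_of_lt (Polynomial.degree_pow_le_of_le (a := 1) k ?_) ?_
    · refine (Polynomial.degree_sub_le _ _).trans (max_le ?_ ?_)
      · exact Polynomial.degree_C_le.trans (by norm_num)
      · exact Polynomial.degree_X_le
    · rw [mul_one]
      exact_mod_cast Nat.lt_succ_of_le hk)
  simp only [Polynomial.eval_pow, Polynomial.eval_sub, Polynomial.eval_C, Polynomial.eval_X] at h
  rw [h, Polynomial.derivative_pow]
  rcases k with _ | _ | k
  · simp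
  · simp
  · simp

/-- The exponential sum `∑ β_j exp ((lam - j) z)`. -/
noncomputable def expSum (lam : ℝ) (p : ℕ) (z : ℂ) : ℂ :=
  ∑ j ∈ Finset.range (p + 1), (beta lam p j : ℂ) * Complex.exp (((lam : ℂ) - j) * z)

lemma differentiable_expSum (lam : ℝ) (p : ℕ) : Differentiable ℂ (expSum lam p) := by
  unfold expSum
  fun_prop

/-- The coefficient of `z^i` in the exponential sum is the moment `∑ β_j (lam - j)^i` over `i!`. For
`i ≤ p` only `i = 1` survives, so the difference is a combination of `p + 1` Taylor remainders of
the exponential. -/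
lemma expSum_sub_isBigO (lam : ℝ) (p : ℕ) (hp : 1 ≤ p) :
    (fun z => expSum lam p z - z) =O[𝓝 0] fun z : ℂ => z ^ (p + 1) := by
  have key : ∀ z : ℂ, expSum lam p z - z = ∑ j ∈ Finset.range (p + 1), (beta lam p j : ℂ) *
      (Complex.exp (((lam : ℂ) - j) * z) -
        ∑ i ∈ Finset.range (p + 1), (((lam : ℂ) - j) * z) ^ i / (i.factorial : ℂ)) := by
    intro z
    simp only [mul_sub, Finset.sum_sub_distrib, expSum]
    congr 1
    simp only [Finset.mul_sum]
    rw [Finset.sum_comm]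
    have : ∀ i ∈ Finset.range (p + 1), ∑ j ∈ Finset.range (p + 1),
        (beta lam p j : ℂ) * ((((lam : ℂ) - j) * z) ^ i / (i.factorial : ℂ))
        = if i = 1 then z else 0 := by
      intro i hi
      have h := congrArg (fun x : ℝ => (x : ℂ))
        (sum_beta_mul_sub_pow lam p i (Nat.lt_succ_iff.1 (Finset.mem_range.1 hi)))
      push_cast at h
      have h2 : ∑ j ∈ Finset.range (p + 1),
        (beta lam p j : ℂ) * ((((lam : ℂ) - j) * z) ^ i / (i.factorial : ℂ)) =
          (∑ j ∈ Finset.range (p + 1), (beta lam p j : ℂ) * ((lam : ℂ) - j) ^ i) *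
            (z ^ i / (i.factorial : ℂ)) := by
        rw [Finset.sum_mul]
        refine Finset.sum_congr rfl fun j _ => ?_
        rw [mul_pow]; ring
      rw [h2, h]
      split_ifs with h1
      · simp [h1]
      · simp
    rw [Finset.sum_congr rfl this, Finset.sum_ite_eq' , if_pos (by simp; omega)]
  simp only [key]
  refine IsBigO.fun_sum fun j _ => ?_
  refine IsBigO.const_mul_left ?_ (beta lam p j : ℂ)
  have h1 : Tendsto (fun z : ℂ => ((lam : ℂ) - j) * z) (𝓝 0) (𝓝 0) := by
    have : Continuous fun z : ℂ => ((lam : ℂ) - j) * z := by fun_prop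
    simpa using this.tendsto 0
  refine ((Complex.exp_sub_sum_range_isBigO_pow (p + 1)).comp_tendsto h1).trans ?_
  simp only [Function.comp_def, mul_pow]
  exact IsBigO.const_mul_left (isBigO_refl _ _) _

lemma aeval_basePoly_exp_neg (α r : ℝ) (p : ℕ) (z : ℂ) :
    Polynomial.aeval (Complex.exp (-z)) (basePoly α r p) =
      expSum (r / α) p z * Complex.exp (-((r / α : ℝ) : ℂ) * z) := by
  simp only [basePoly, expSum, map_sum, Polynomial.aeval_monomial, Finset.sum_mul]
  refine Finset.sum_congr rfl fun j _ => ?_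
  rw [mul_assoc, ← Complex.exp_add, ← Complex.exp_nat_mul]
  simp only [Complex.coe_algebraMap]
  congr 2
  ring

lemma exists_expSum_factor (lam : ℝ) (p : ℕ) (hp : 1 ≤ p) :
    ∃ K : ℂ → ℂ, AnalyticAt ℂ K 0 ∧ K 0 = 1 ∧ (∀ z, expSum lam p z = z * K z) ∧
      (fun z => K z - 1) =O[𝓝 0] fun z : ℂ => z ^ p := by
  have hA := expSum_sub_isBigO lam p hp
  have h0 : expSum lam p 0 = 0 := by
    have := hA.eq_zero_imp.self_of_nhds
    simpa using this (by simp)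
  have hd : HasDerivAt (expSum lam p) 1 0 := by
    rw [hasDerivAt_iff_isLittleO]
    simp only [h0, sub_zero, smul_eq_mul, mul_one]
    refine hA.trans_isLittleO ?_
    simpa using isLittleO_pow_pow (𝕜 := ℂ) (m := 1) (n := p + 1) (by omega)
  have hK0 : dslope (expSum lam p) 0 0 = 1 := by rw [dslope_same, hd.deriv]
  have hfac : ∀ z, expSum lam p z = z * dslope (expSum lam p) 0 z := by
    intro z
    have := sub_smul_dslope (expSum lam p) 0 z
    simpa [h0] using this.symm
  refine ⟨dslope (expSum lam p) 0, ?_, hK0, hfac, ?_⟩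
  -- The quotient by `z`, with its removable singularity filled, is given by the shifted power
  -- series.
  · obtain ⟨q, hq⟩ := (differentiable_expSum lam p).analyticAt 0
    exact ⟨_, hq.has_fpower_series_dslope_fslope⟩
  · obtain ⟨C, hC⟩ := hA.bound
    refine IsBigO.of_bound C ?_
    filter_upwards [hC] with z hz
    rcases eq_or_ne z 0 with rfl | hz0
    · rw [hK0]
      simp [show p ≠ 0 by omega]
    · rw [hfac z, show z * dslope (expSum lam p) 0 z - z = z * (dslope (expSum lam p) 0 z - 1) by
        ring, norm_mul, pow_succ, norm_mul] at hz
      have hzp : 0 < ‖z‖ := norm_pos_iff.2 hz0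
      nlinarith

lemma mul_cpow_of_arg_add_mem {x y : ℂ} (hx : x ≠ 0) (hy : y ≠ 0)
    (h : x.arg + y.arg ∈ Ioc (-Real.pi) Real.pi) (a : ℂ) : (x * y) ^ a = x ^ a * y ^ a := by
  rw [Complex.cpow_def_of_ne_zero (mul_ne_zero hx hy), Complex.cpow_def_of_ne_zero hx,
    Complex.cpow_def_of_ne_zero hy, Complex.log_mul hx hy h, add_mul, Complex.exp_add]

/-- The local structure of the symbol at the origin. -/
lemma exists_analytic_symbol (α : ℝ) (hα : 0 < α) (r : ℝ) (p : ℕ) (hp : 1 ≤ p) :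
    ∃ G : ℂ → ℂ, AnalyticAt ℂ G 0 ∧ ((fun z : ℂ => G z - 1) =O[𝓝 0] fun z : ℂ => z ^ p) ∧
      ∀ᶠ z in 𝓝 (0 : ℂ), 0 ≤ z.re → z ≠ 0 →
        Polynomial.aeval (Complex.exp (-z)) (basePoly α r p) ∈ Complex.slitPlane ∧
        genWC α r p (Complex.exp (-z)) * Complex.exp (r * z) = z ^ (α : ℂ) * G z := by
  obtain ⟨K, hKan, hK0, hfac, hKO⟩ := exists_expSum_factor (r / α) p hp
  have hK0s : K 0 ∈ Complex.slitPlane := by simp [hK0]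
  refine ⟨fun z => K z ^ (α : ℂ), hKan.cpow analyticAt_const hK0s, ?_, ?_⟩
  · have hd : HasDerivAt (fun w : ℂ => w ^ (α : ℂ)) ((α : ℂ) * 1 ^ ((α : ℂ) - 1) * 1) (K 0) := by
      have := (hasDerivAt_id (K 0)).cpow_const (c := (α : ℂ)) hK0s
      simpa [hK0, Function.comp_def] using this
    have h1 := hd.isBigO_sub
    rw [hK0] at h1
    have h2 := h1.comp_tendsto (by simpa [hK0] using hKan.continuousAt.tendsto)
    simp only [Function.comp_def, Complex.one_cpow] at h2
    exact h2.trans hKO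
  · set E : ℂ → ℂ := fun z => Complex.exp (-((r / α : ℝ) : ℂ) * z) with hE
    have hEc : Continuous E := by simp only [hE]; fun_prop
    have hE0 : E 0 = 1 := by simp [hE]
    have hargK : Tendsto (fun z => (K z).arg) (𝓝 0) (𝓝 0) := by
      have := (Complex.continuousAt_arg hK0s).tendsto.comp hKan.continuousAt.tendsto
      simpa [hK0, Function.comp_def] using this
    have hargE : Tendsto (fun z => (E z).arg) (𝓝 0) (𝓝 0) := by
      have := (Complex.continuousAt_arg (x := E 0) (by simp [hE0])).tendsto.comp
        hEc.continuousAt.tendsto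
      simpa [hE0, Function.comp_def] using this
    have him : Tendsto (fun z : ℂ => ((-((r / α : ℝ) : ℂ) * z).im)) (𝓝 0) (𝓝 0) := by
      have : Continuous fun z : ℂ => ((-((r / α : ℝ) : ℂ) * z).im) := by fun_prop
      simpa using this.tendsto 0
    have hpi := Real.pi_pos
    have hKne : ∀ᶠ z in 𝓝 (0 : ℂ), K z ≠ 0 :=
      hKan.continuousAt.eventually_ne (by simp [hK0])
    -- The argument of `z` takes up to `π/2` in the closed half plane; two further arguments below
    -- `π/8` keep the total inside `(-π, π)`, so principal powers multiply and the product stays in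
    -- the slit plane.
    have hnb : Ioo (-(Real.pi / 8)) (Real.pi / 8) ∈ 𝓝 (0 : ℝ) :=
      Ioo_mem_nhds (by linarith) (by linarith)
    filter_upwards [hargK hnb, hargE hnb, him hnb, hKne] with z hz1 hz2 hz3 hz4 hre hz0
    simp only [mem_preimage, mem_Ioo] at hz1 hz2 hz3
    have hEne : E z ≠ 0 := Complex.exp_ne_zero _
    have hargz : |z.arg| ≤ Real.pi / 2 := Complex.abs_arg_le_pi_div_two_iff.2 hre
    rw [abs_le] at hargz
    have hKE : (K z * E z).arg = (K z).arg + (E z).arg :=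
      Complex.arg_mul hz4 hEne ⟨by linarith, by linarith⟩
    have hKEne := mul_ne_zero hz4 hEne
    have hP : Polynomial.aeval (Complex.exp (-z)) (basePoly α r p) = z * (K z * E z) := by
      rw [aeval_basePoly_exp_neg, hfac]
      ring
    have hsum : z.arg + (K z * E z).arg ∈ Ioo (-Real.pi) Real.pi := by
      rw [hKE]
      exact ⟨by linarith, by linarith⟩
    refine ⟨?_, ?_⟩
    · rw [hP, Complex.mem_slitPlane_iff_arg, Complex.arg_mul hz0 hKEne (Ioo_subset_Ioc_self hsum)]
      exact ⟨hsum.2.ne, mul_ne_zero hz0 hKEne⟩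
    · rw [genWC, hP, mul_cpow_of_arg_add_mem hz0 hKEne (Ioo_subset_Ioc_self hsum),
        mul_cpow_of_arg_add_mem hz4 hEne ⟨by linarith, by linarith⟩]
      have hEα : E z ^ (α : ℂ) = Complex.exp (-(r * z)) := by
        rw [Complex.cpow_def_of_ne_zero hEne, hE, Complex.log_exp (by linarith) (by linarith)]
        congr 1
        have : (α : ℂ) ≠ 0 := by exact_mod_cast hα.ne'
        push_cast
        field_simp
      rw [hEα, mul_assoc, mul_assoc, ← Complex.exp_add]
      simp

/-! ### The generating series on the closed right half plane -/

/-- The Dirichlet type series `∑ w_k exp (-k z)`. -/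
noncomputable def expSeries (w : ℕ → ℝ) (z : ℂ) : ℂ :=
  ∑' k : ℕ, (w k : ℂ) * Complex.exp (-(k : ℂ) * z)

lemma norm_expSeries_term_le (w : ℕ → ℝ) (k : ℕ) {z : ℂ} (hz : 0 ≤ z.re) :
    ‖(w k : ℂ) * Complex.exp (-(k : ℂ) * z)‖ ≤ |w k| := by
  rw [norm_mul, Complex.norm_real, Real.norm_eq_abs, Complex.norm_exp]
  refine mul_le_of_le_one_right (abs_nonneg _) (Real.exp_le_one_iff.2 ?_)
  simp only [neg_mul, Complex.neg_re, Complex.mul_re, Complex.natCast_re, Complex.natCast_im,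
    zero_mul, sub_zero, neg_nonpos]
  positivity

lemma norm_expSeries_le {w : ℕ → ℝ} (hw : Summable fun k => |w k|) {z : ℂ} (hz : 0 ≤ z.re) :
    ‖expSeries w z‖ ≤ ∑' k, |w k| :=
  tsum_of_norm_bounded hw.hasSum fun k => norm_expSeries_term_le w k hz

lemma continuousOn_expSeries {w : ℕ → ℝ} (hw : Summable fun k => |w k|) :
    ContinuousOn (expSeries w) {z : ℂ | 0 ≤ z.re} :=
  continuousOn_tsum (fun k => by fun_prop) hw fun k _ hz => norm_expSeries_term_le w k hz

lemma differentiableOn_expSeries {w : ℕ → ℝ} (hw : Summable fun k => |w k|) :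
    DifferentiableOn ℂ (expSeries w) {z : ℂ | 0 < z.re} :=
  Complex.differentiableOn_tsum_of_summable_norm hw (fun k => by fun_prop)
    (isOpen_lt continuous_const Complex.continuous_re)
    fun k _ hz => norm_expSeries_term_le w k (le_of_lt hz)

lemma expSeries_ofReal {w : ℕ → ℝ} {W : ℝ → ℝ} (hw : IsGeneratedBy w W) {x : ℝ} (hx : 0 < x) :
    expSeries w x = W (Real.exp (-x)) := by
  have h := hw.hasSum (Real.exp (-x)) ⟨(Real.exp_pos _).le, by simpa using hx⟩
  have h2 := Complex.hasSum_ofReal.2 h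
  rw [← h2.tsum_eq, expSeries]
  congr 1
  ext k
  rw [← Real.exp_nat_mul]
  push_cast
  congr 2
  ring

/-- Real and principal complex powers agree for a nonnegative base; since the polynomial value is
real here, membership in the slit plane says that it is positive. -/
lemma genW_exp_neg {α r : ℝ} {p : ℕ} {x : ℝ}
    (h : Polynomial.aeval (Complex.exp (-(x : ℂ))) (basePoly α r p) ∈ Complex.slitPlane) :
    ((genW α r p (Real.exp (-x)) : ℝ) : ℂ) = genWC α r p (Complex.exp (-(x : ℂ))) := by
  have h1 : Polynomial.aeval (Complex.exp (-(x : ℂ))) (basePoly α r p) =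
      (((basePoly α r p).eval (Real.exp (-x)) : ℝ) : ℂ) := by
    rw [show Complex.exp (-(x : ℂ)) = ((Real.exp (-x) : ℝ) : ℂ) by push_cast; rfl]
    exact Polynomial.aeval_algebraMap_apply_eq_algebraMap_eval (A := ℂ) _ _
  rw [h1, Complex.ofReal_mem_slitPlane] at h
  rw [genW, genWC, h1, Complex.ofReal_cpow h.le]

/-- Near the origin, the series coincides with the principal power in the right half plane. -/
lemma exists_expSeries_sub_cpow_le {α : ℝ} (hα : 0 < α) {r : ℝ} {p : ℕ} (hp : 1 ≤ p)
    {w : ℕ → ℝ} (hw : IsGeneratedBy w (genW α r p)) :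
    ∃ δ > 0, ∃ C, ∀ z : ℂ, 0 ≤ z.re → z ≠ 0 → ‖z‖ < δ →
      ‖expSeries w z * Complex.exp (r * z) - z ^ (α : ℂ)‖ ≤ C * ‖z‖ ^ (α + p) := by
  obtain ⟨G, hGan, hGO, hG⟩ := exists_analytic_symbol α hα r p hp
  obtain ⟨C, hC⟩ := hGO.bound
  obtain ⟨δ, hδ, hball⟩ := Metric.eventually_nhds_iff_ball.1
    ((hG.and hC).and hGan.eventually_analyticAt)
  refine ⟨δ, hδ, C, ?_⟩
  have hΩ : IsOpen {z : ℂ | 0 < z.re} := isOpen_lt continuous_const Complex.continuous_re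
  set U : Set ℂ := {z : ℂ | 0 < z.re} ∩ Metric.ball 0 δ with hU
  have hUo : IsOpen U := hΩ.inter Metric.isOpen_ball
  have hUc : Convex ℝ U := (convex_halfSpace_re_gt 0).inter (convex_ball 0 δ)
  have hne : ∀ {z : ℂ}, 0 < z.re → z ≠ 0 := by
    rintro z hz rfl
    simp at hz
  have hd1 : DifferentiableOn ℂ (fun z => expSeries w z * Complex.exp (r * z)) U :=
    ((differentiableOn_expSeries hw.summable_abs).mono inter_subset_left).fun_mul (by fun_prop)
  have hd2 : AnalyticOnNhd ℂ (fun z => z ^ (α : ℂ) * G z) U := by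
    intro z hz
    have h1 : AnalyticAt ℂ (fun z : ℂ => z ^ (α : ℂ)) z :=
      analyticAt_id.cpow analyticAt_const (Or.inl hz.1)
    exact h1.fun_mul (hball z hz.2).2
  have heqU : EqOn (fun z => expSeries w z * Complex.exp (r * z)) (fun z => z ^ (α : ℂ) * G z)
      U := by
    -- Identity theorem on the half disc: the two sides agree on the real segment `(0, δ)`, where
    -- the generating function is known, and this segment accumulates at `δ/2`.
    refine AnalyticOnNhd.eqOn_of_preconnected_of_frequently_eq (z₀ := ((δ / 2 : ℝ) : ℂ))
      ?_ ?_ hUc.isPreconnected ?_ ?_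
    · exact hd1.analyticOnNhd hUo
    · exact hd2
    · refine ⟨by simpa using hδ, ?_⟩
      rw [mem_ball_zero_iff, Complex.norm_real, Real.norm_of_nonneg (by positivity)]
      linarith
    · have ht : Tendsto (fun x : ℝ => (x : ℂ)) (𝓝[≠] (δ / 2)) (𝓝[≠] ((δ / 2 : ℝ) : ℂ)) := by
        refine tendsto_nhdsWithin_iff.2 ⟨(Complex.continuous_ofReal.tendsto _).mono_left
          nhdsWithin_le_nhds, ?_⟩
        filter_upwards [self_mem_nhdsWithin] with x hx
        exact fun h => hx (Complex.ofReal_injective h)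
      refine ht.frequently (Eventually.frequently ?_)
      have hmem : Ioo 0 δ ∈ 𝓝[≠] (δ / 2) :=
        nhdsWithin_le_nhds (Ioo_mem_nhds (by linarith) (by linarith))
      filter_upwards [hmem] with x hx
      have hb := (hball (x : ℂ) (by
        rw [mem_ball_zero_iff, Complex.norm_real, Real.norm_of_nonneg hx.1.le]
        exact hx.2)).1.1 (by simpa using hx.1.le) (by simpa using hx.1.ne')
      rw [expSeries_ofReal hw hx.1, genW_exp_neg hb.1]
      exact hb.2
  intro z hre hz0 hzδ
  have heq : expSeries w z * Complex.exp (r * z) = z ^ (α : ℂ) * G z := by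
    have hzb : z ∈ Metric.ball (0 : ℂ) δ := by simpa using hzδ
    -- Points of the imaginary axis are reached from the right; both sides are continuous up to the
    -- punctured boundary.
    have ht : Tendsto (fun t : ℝ => z + (t : ℂ)) (𝓝[>] 0) (𝓝[U] z) := by
      refine tendsto_nhdsWithin_iff.2 ⟨?_, ?_⟩
      · have : Continuous fun t : ℝ => z + (t : ℂ) := by fun_prop
        simpa using (this.tendsto 0).mono_left nhdsWithin_le_nhds
      · have hc : Tendsto (fun t : ℝ => z + (t : ℂ)) (𝓝[>] 0) (𝓝 z) := by
          have : Continuous fun t : ℝ => z + (t : ℂ) := by fun_prop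
          simpa using (this.tendsto 0).mono_left nhdsWithin_le_nhds
        filter_upwards [hc (Metric.isOpen_ball.mem_nhds hzb), self_mem_nhdsWithin] with t h1 h2
        refine ⟨?_, h1⟩
        have : (0 : ℝ) < t := h2
        simp only [mem_ofPred_eq, Complex.add_re, Complex.ofReal_re]
        linarith
    have hsub : U ⊆ {z : ℂ | 0 ≤ z.re} := fun y hy => (show 0 < y.re from hy.1).le
    have h1 : Tendsto (fun y => expSeries w y * Complex.exp (r * y)) (𝓝[U] z)
        (𝓝 (expSeries w z * Complex.exp (r * z))) :=
      (((continuousOn_expSeries hw.summable_abs) z hre).mono hsub).mul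
        (Continuous.continuousWithinAt (by fun_prop))
    have hslit : z ∈ Complex.slitPlane := by
      rcases hre.lt_or_eq with h | h
      · exact Or.inl h
      · exact Or.inr fun him => hz0 (Complex.ext h.symm him)
    have h2 : Tendsto (fun y => y ^ (α : ℂ) * G y) (𝓝[U] z) (𝓝 (z ^ (α : ℂ) * G z)) :=
      ((continuousAt_id.cpow continuousAt_const hslit).mul
        (hball z hzb).2.continuousAt).continuousWithinAt
    refine tendsto_nhds_unique (h1.comp ht) ((h2.comp ht).congr' ?_)
    filter_upwards [ht self_mem_nhdsWithin] with t h
    exact (heqU h).symm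
  have hCz := (hball z (by simpa using hzδ)).1.2
  have hzp : 0 < ‖z‖ := norm_pos_iff.2 hz0
  rw [heq, show z ^ (α : ℂ) * G z - z ^ (α : ℂ) = z ^ (α : ℂ) * (G z - 1) by ring, norm_mul,
    Complex.norm_cpow_real, Real.rpow_add hzp, Real.rpow_natCast]
  rw [norm_pow] at hCz
  calc ‖z‖ ^ α * ‖G z - 1‖ ≤ ‖z‖ ^ α * (C * ‖z‖ ^ p) := by gcongr
    _ = C * (‖z‖ ^ α * ‖z‖ ^ p) := by ring

/-- The symbol estimate on the whole imaginary axis. -/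
lemma exists_expSeries_sub_cpow_le_of_re_eq_zero {α : ℝ} (hα : 0 < α) {r : ℝ} {p : ℕ}
    (hp : 1 ≤ p) {w : ℕ → ℝ} (hw : IsGeneratedBy w (genW α r p)) :
    ∃ C, ∀ z : ℂ, z.re = 0 → z ≠ 0 →
      ‖expSeries w z * Complex.exp (r * z) - z ^ (α : ℂ)‖ ≤ C * ‖z‖ ^ (α + p) := by
  obtain ⟨δ, hδ, C, hC⟩ := exists_expSeries_sub_cpow_le hα hp hw
  set S := ∑' k, |w k| with hS
  have hS0 : 0 ≤ S := tsum_nonneg fun k => abs_nonneg _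
  -- For `‖z‖ ≥ δ` the crude bound `S + ‖z‖^α` is enough: multiplying its terms by `(‖z‖/δ)^(α+p)`
  -- and `(‖z‖/δ)^p`, both at least one, gives the second constant.
  refine ⟨max C (S / δ ^ (α + p) + 1 / δ ^ p), fun z hre hz0 => ?_⟩
  have hzp : 0 < ‖z‖ := norm_pos_iff.2 hz0
  have hpos : 0 < ‖z‖ ^ (α + p) := Real.rpow_pos_of_pos hzp _
  rcases lt_or_ge ‖z‖ δ with h | h
  · refine (hC z hre.ge hz0 h).trans ?_
    gcongr
    exact le_max_left _ _
  · have hexp : ‖Complex.exp (r * z)‖ = 1 := by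
      rw [Complex.norm_exp]
      simp [hre]
    have hαp : 0 < α + p := by positivity
    have hle : δ ^ (α + p) ≤ ‖z‖ ^ (α + p) := Real.rpow_le_rpow hδ.le h hαp.le
    have hδp : 0 < δ ^ (α + p) := Real.rpow_pos_of_pos hδ _
    calc ‖expSeries w z * Complex.exp (r * z) - z ^ (α : ℂ)‖
        ≤ ‖expSeries w z * Complex.exp (r * z)‖ + ‖z ^ (α : ℂ)‖ := norm_sub_le _ _
      _ ≤ S + ‖z‖ ^ α := by
          rw [norm_mul, hexp, mul_one, Complex.norm_cpow_real]
          gcongr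
          exact norm_expSeries_le hw.summable_abs hre.ge
      _ ≤ S * (‖z‖ ^ (α + p) / δ ^ (α + p)) + ‖z‖ ^ α * (‖z‖ ^ p / δ ^ p) := by
          gcongr
          · exact le_mul_of_one_le_right hS0 ((one_le_div hδp).2 hle)
          · refine le_mul_of_one_le_right (by positivity) ((one_le_div (by positivity)).2 ?_)
            gcongr
      _ = (S / δ ^ (α + p) + 1 / δ ^ p) * ‖z‖ ^ (α + p) := by
          rw [Real.rpow_add hzp, Real.rpow_natCast]
          ring
      _ ≤ _ := by
          gcongr
          exact le_max_right _ _

/-! ### Laplace transforms of powers and weighted integrability -/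

section Integrals

lemma integrableOn_rpow_mul_exp_neg {b ε : ℝ} (hb : -1 < b) (hε : 0 < ε) :
    IntegrableOn (fun t : ℝ => t ^ b * Real.exp (-ε * t)) (Ioi 0) := by
  simpa using integrableOn_rpow_mul_exp_neg_mul_rpow (p := 1) hb one_pos hε

lemma norm_rpow_mul_cexp {b t : ℝ} (ht : 0 < t) (z : ℂ) :
    ‖((t ^ b : ℝ) : ℂ) * Complex.exp (-z * t)‖ = t ^ b * Real.exp (-z.re * t) := by
  rw [norm_mul, Complex.norm_real, Real.norm_of_nonneg (by positivity), Complex.norm_exp]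
  simp

lemma aestronglyMeasurable_rpow_mul_cexp (b : ℝ) (z : ℂ) (μ : Measure ℝ) :
    AEStronglyMeasurable (fun t : ℝ => ((t ^ b : ℝ) : ℂ) * Complex.exp (-z * t)) μ := by
  have : Measurable (fun t : ℝ => ((t ^ b : ℝ) : ℂ) * Complex.exp (-z * t)) := by fun_prop
  exact this.aestronglyMeasurable

lemma integrableOn_rpow_mul_cexp {b : ℝ} (hb : -1 < b) {z : ℂ} (hz : 0 < z.re) :
    IntegrableOn (fun t : ℝ => ((t ^ b : ℝ) : ℂ) * Complex.exp (-z * t)) (Ioi 0) := by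
  refine (integrableOn_rpow_mul_exp_neg hb hz).mono'
    (aestronglyMeasurable_rpow_mul_cexp _ _ _) ?_
  filter_upwards [ae_restrict_mem measurableSet_Ioi] with t ht
  exact (norm_rpow_mul_cexp ht z).le

lemma differentiableAt_laplace_rpow {b : ℝ} (hb : -1 < b) {z : ℂ} (hz : 0 < z.re) :
    DifferentiableAt ℂ
      (fun z : ℂ => ∫ t in Ioi (0 : ℝ), ((t ^ b : ℝ) : ℂ) * Complex.exp (-z * t)) z := by
  -- On this smaller half plane the exponential decay is uniform, which gives a dominating function
  -- for the derivative.
  have hnhds : {y : ℂ | z.re / 2 < y.re} ∈ 𝓝 z :=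
    (isOpen_lt continuous_const Complex.continuous_re).mem_nhds (show z.re / 2 < z.re by linarith)
  have hz2 : 0 < z.re / 2 := by linarith
  refine (hasDerivAt_integral_of_dominated_loc_of_deriv_le
    (μ := volume.restrict (Ioi (0 : ℝ)))
    (F' := fun y t => ((t ^ b : ℝ) : ℂ) * (Complex.exp (-y * t) * (-1 * t)))
    (bound := fun t => t ^ (b + 1) * Real.exp (-(z.re / 2) * t)) hnhds
    (Eventually.of_forall fun y => aestronglyMeasurable_rpow_mul_cexp b y _)
    (integrableOn_rpow_mul_cexp hb hz) ?_ ?_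
    (integrableOn_rpow_mul_exp_neg (by linarith) hz2) ?_).2.differentiableAt
  · refine Measurable.aestronglyMeasurable ?_
    fun_prop
  · filter_upwards [ae_restrict_mem measurableSet_Ioi] with t ht y hy
    have ht' : (0 : ℝ) < t := ht
    have hy' : z.re / 2 < y.re := hy
    rw [← mul_assoc, norm_mul, norm_rpow_mul_cexp ht', Real.rpow_add_one ht'.ne']
    simp only [norm_mul, norm_neg, norm_one, one_mul, Complex.norm_real,
      Real.norm_of_nonneg ht'.le]
    have : Real.exp (-y.re * t) ≤ Real.exp (-(z.re / 2) * t) := by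
      apply Real.exp_le_exp.2
      nlinarith
    calc t ^ b * Real.exp (-y.re * t) * t ≤ t ^ b * Real.exp (-(z.re / 2) * t) * t := by gcongr
      _ = _ := by ring
  · refine Eventually.of_forall fun t y _ => ?_
    have h1 : HasDerivAt (fun y : ℂ => -y * (t : ℂ)) (-1 * t) y :=
      ((hasDerivAt_id y).neg).mul_const _
    exact h1.cexp.const_mul _

/-- The Laplace transform of a power on the right half plane. -/
lemma integral_rpow_mul_cexp {β : ℝ} (hβ : 0 < β) {z : ℂ} (hz : 0 < z.re) :
    ∫ t in Ioi (0 : ℝ), ((t ^ (β - 1) : ℝ) : ℂ) * Complex.exp (-z * t) =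
      Real.Gamma β * z ^ (-(β : ℂ)) := by
  have hΩ : IsOpen {z : ℂ | 0 < z.re} := isOpen_lt continuous_const Complex.continuous_re
  have h1 : AnalyticOnNhd ℂ
      (fun z : ℂ => ∫ t in Ioi (0 : ℝ), ((t ^ (β - 1) : ℝ) : ℂ) * Complex.exp (-z * t))
      {z : ℂ | 0 < z.re} :=
    DifferentiableOn.analyticOnNhd (fun y hy =>
      (differentiableAt_laplace_rpow (by linarith) hy).differentiableWithinAt) hΩ
  have h2 : AnalyticOnNhd ℂ (fun z : ℂ => Real.Gamma β * z ^ (-(β : ℂ))) {z : ℂ | 0 < z.re} := by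
    intro y hy
    have : AnalyticAt ℂ (fun z : ℂ => z ^ (-(β : ℂ))) y :=
      analyticAt_id.cpow analyticAt_const (Or.inl hy)
    exact analyticAt_const.fun_mul this
  -- Both sides are analytic on the half plane, and the positive reals, where the formula is the
  -- classical Gamma integral, accumulate at `1`.
  refine h1.eqOn_of_preconnected_of_frequently_eq h2 (convex_halfSpace_re_gt 0).isPreconnected
    (z₀ := ((1 : ℝ) : ℂ)) (by simp) ?_ hz
  have ht : Tendsto (fun x : ℝ => (x : ℂ)) (𝓝[≠] 1) (𝓝[≠] ((1 : ℝ) : ℂ)) := by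
    refine tendsto_nhdsWithin_iff.2 ⟨(Complex.continuous_ofReal.tendsto _).mono_left
      nhdsWithin_le_nhds, ?_⟩
    filter_upwards [self_mem_nhdsWithin] with x hx
    exact fun h => hx (Complex.ofReal_injective h)
  refine ht.frequently (Eventually.frequently ?_)
  filter_upwards [nhdsWithin_le_nhds (Ioi_mem_nhds (zero_lt_one' ℝ))] with x hx
  have hx' : (0 : ℝ) < x := hx
  have h := congrArg (fun y : ℝ => (y : ℂ)) (Real.integral_rpow_mul_exp_neg_mul_Ioi hβ hx')
  rw [← integral_complex_ofReal] at h
  calc ∫ t in Ioi (0 : ℝ), ((t ^ (β - 1) : ℝ) : ℂ) * Complex.exp (-(x : ℂ) * t)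
      = ∫ t in Ioi (0 : ℝ), ((t ^ (β - 1) * Real.exp (-(x * t)) : ℝ) : ℂ) := by
        congr 1
        ext t
        push_cast
        congr 2
        ring
    _ = _ := by
        rw [h, one_div, Real.inv_rpow hx'.le, ← Real.rpow_neg hx'.le]
        push_cast
        rw [Complex.ofReal_cpow hx'.le]
        push_cast
        ring

lemma integrableOn_rpow_mul_of_continuous {b : ℝ} (hb : -1 < b) (hb0 : b ≤ 0) {g : ℝ → ℝ}
    (hg : Continuous g) (hgi : Integrable g) :
    IntegrableOn (fun t => t ^ b * g t) (Ioi 0) := by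
  rw [← Ioc_union_Ioi_eq_Ioi zero_le_one]
  refine IntegrableOn.union ?_ ?_
  · exact ((intervalIntegrable_iff_integrableOn_Ioc_of_le zero_le_one).1
      ((intervalIntegral.intervalIntegrable_rpow' hb).mul_continuousOn hg.continuousOn))
  · have hm : Measurable fun t : ℝ => t ^ b * g t := by
      have := hg.measurable
      fun_prop
    refine hgi.norm.integrableOn.mono' hm.aestronglyMeasurable ?_
    filter_upwards [ae_restrict_mem measurableSet_Ioi] with t ht
    have ht' : (1 : ℝ) < t := ht
    rw [norm_mul, Real.norm_of_nonneg (by positivity)]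
    exact mul_le_of_le_one_left (norm_nonneg _) (Real.rpow_le_one_of_one_le_of_nonpos ht'.le hb0)

/-- Near the origin the bound `C |ξ|^a` is integrable since `a > -1`; at infinity the decay gives `C
|ξ|^(a-M)`, integrable since `a - M < -1`. -/
lemma integrable_abs_rpow_mul_norm {F : ℝ → ℂ} (hF : Continuous F) {C a : ℝ} {M : ℕ}
    (h0 : ∀ ξ, ‖F ξ‖ ≤ C) (hM : ∀ ξ, |ξ| ^ M * ‖F ξ‖ ≤ C) (ha : -1 < a) (haM : a < M - 1) :
    Integrable fun ξ => |ξ| ^ a * ‖F ξ‖ := by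
  have key : ∀ {F : ℝ → ℂ}, Continuous F → (∀ ξ, ‖F ξ‖ ≤ C) → (∀ ξ, |ξ| ^ M * ‖F ξ‖ ≤ C) →
      IntegrableOn (fun ξ => |ξ| ^ a * ‖F ξ‖) (Ioi 0) := by
    intro F hF h0 hM
    have hm : Measurable fun ξ => |ξ| ^ a * ‖F ξ‖ := by
      have := hF.measurable
      fun_prop
    rw [← Ioc_union_Ioi_eq_Ioi zero_le_one]
    refine IntegrableOn.union ?_ ?_
    · have hi : IntegrableOn (fun ξ : ℝ => ξ ^ a * C) (Ioc 0 1) :=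
        ((intervalIntegrable_iff_integrableOn_Ioc_of_le zero_le_one).1
          (intervalIntegral.intervalIntegrable_rpow' ha)).mul_const C
      refine hi.mono' hm.aestronglyMeasurable ?_
      filter_upwards [ae_restrict_mem measurableSet_Ioc] with ξ hξ
      rw [norm_mul, norm_norm, abs_of_pos hξ.1,
        Real.norm_of_nonneg (Real.rpow_nonneg hξ.1.le _)]
      exact mul_le_mul_of_nonneg_left (h0 ξ) (Real.rpow_nonneg hξ.1.le _)
    · have hi : IntegrableOn (fun ξ : ℝ => ξ ^ (a - M) * C) (Ioi 1) :=
        (integrableOn_Ioi_rpow_of_lt (by linarith) one_pos).mul_const C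
      refine hi.mono' hm.aestronglyMeasurable ?_
      filter_upwards [ae_restrict_mem measurableSet_Ioi] with ξ hξ
      have hξ' : (1 : ℝ) < ξ := hξ
      have hξ0 : (0 : ℝ) < ξ := by linarith
      have h := hM ξ
      rw [abs_of_pos hξ0] at h
      rw [norm_mul, norm_norm, abs_of_pos hξ0, Real.norm_of_nonneg (Real.rpow_nonneg hξ0.le _)]
      calc ξ ^ a * ‖F ξ‖ = ξ ^ (a - M) * (ξ ^ M * ‖F ξ‖) := by
            rw [← mul_assoc, ← Real.rpow_natCast ξ M, ← Real.rpow_add hξ0, sub_add_cancel]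
        _ ≤ _ := mul_le_mul_of_nonneg_left h (Real.rpow_nonneg hξ0.le _)
  rw [← integrableOn_univ, ← Iio_union_Ici (a := (0 : ℝ))]
  refine IntegrableOn.union ?_ ((integrableOn_Ici_iff_integrableOn_Ioi).2 (key hF h0 hM))
  have h := key (F := fun ξ => F (-ξ)) (by fun_prop) (fun ξ => h0 _)
    (fun ξ => by simpa using hM (-ξ))
  rw [← (Measure.measurePreserving_neg volume).integrableOn_comp_preimage
    (MeasurableEquiv.neg ℝ).measurableEmbedding]
  simpa [Function.comp_def] using h

end Integrals

/-! ### Fourier multipliers for the derivative and the difference operator -/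

open FourierTransform

lemma iteratedDeriv_clm_comp {E F : Type*} [NormedAddCommGroup E] [NormedSpace ℝ E]
    [NormedAddCommGroup F] [NormedSpace ℝ F] (L : E →L[ℝ] F) {f : ℝ → E} {n : ℕ}
    (hf : ContDiff ℝ n f) (x : ℝ) :
    iteratedDeriv n (fun y => L (f y)) x = L (iteratedDeriv n f x) := by
  rw [iteratedDeriv_eq_iteratedFDeriv, iteratedDeriv_eq_iteratedFDeriv]
  have := L.iteratedFDeriv_comp_left (f := f) (hf.contDiffAt (x := x)) le_rfl
  rw [show (fun y => L (f y)) = L ∘ f from rfl, this]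
  simp

lemma norm_fourier_le (g : ℝ → ℂ) (ξ : ℝ) : ‖𝓕 g ξ‖ ≤ ∫ x, ‖g x‖ :=
  VectorFourier.norm_fourierIntegral_le_integral_norm _ _ _ _ _

lemma continuous_fourier_of_integrable {g : ℝ → ℂ} (hg : Integrable g) : Continuous (𝓕 g) :=
  VectorFourier.fourierIntegral_continuous Real.continuous_fourierChar
    (by exact (innerSL ℝ).continuous₂) hg

/-- The frequency variable `2 π i ξ`. -/
noncomputable def freq (ξ : ℝ) : ℂ := 2 * Real.pi * ξ * Complex.I

@[simp] lemma freq_re (ξ : ℝ) : (freq ξ).re = 0 := by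
  simp [freq, Complex.mul_re, Complex.mul_im]

lemma norm_freq (ξ : ℝ) : ‖freq ξ‖ = 2 * Real.pi * |ξ| := by
  simp [freq, abs_of_pos Real.pi_pos]

lemma freq_ne_zero {ξ : ℝ} (h : ξ ≠ 0) : freq ξ ≠ 0 := by
  simp [freq, h, Real.pi_ne_zero]

lemma continuous_freq : Continuous freq := by
  unfold freq
  fun_prop

lemma norm_cexp_freq_mul (ξ x : ℝ) : ‖Complex.exp (freq ξ * x)‖ = 1 := by
  rw [Complex.norm_exp]
  simp [Complex.mul_re]

lemma freq_mem_slitPlane {ξ : ℝ} (h : ξ ≠ 0) : freq ξ ∈ Complex.slitPlane := by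
  refine Or.inr ?_
  simp [freq, Complex.mul_re, Complex.mul_im, h, Real.pi_ne_zero]

lemma fourierInv_eq_integral_cexp (H : ℝ → ℂ) (x : ℝ) :
    𝓕⁻ H x = ∫ ξ, Complex.exp (freq ξ * x) * H ξ := by
  rw [Real.fourierInv_eq']
  congr 1
  ext ξ
  simp only [smul_eq_mul, freq]
  congr 2
  simp
  ring

/-- Integrability of the frequency moments `0, …, N` makes the inverse transform `C ^ N`. -/
lemma contDiff_fourierInv {H : ℝ → ℂ} {N : ℕ}
    (hH : ∀ n ≤ N, Integrable fun ξ : ℝ => (ξ : ℂ) ^ n * H ξ) :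
    ContDiff ℝ N (𝓕⁻ H) ∧
      ∀ x, iteratedDeriv N (𝓕⁻ H) x = ∫ ξ, Complex.exp (freq ξ * x) * (freq ξ ^ N * H ξ) := by
  have hneg : ∀ n ≤ N, Integrable fun ξ : ℝ => ξ ^ n • H (-ξ) := by
    intro n hn
    have h := (hH n hn).comp_neg.const_mul ((-1 : ℂ) ^ n)
    refine h.congr (Eventually.of_forall fun ξ => ?_)
    simp only [Complex.ofReal_neg, Complex.real_smul, Complex.ofReal_pow]
    rw [← mul_assoc, ← mul_pow]
    simp
  rw [Real.fourierInv_eq_fourier_comp_neg]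
  refine ⟨Real.contDiff_fourier (N := N) fun n hn => ?_, fun x => ?_⟩
  · refine (hneg n (by exact_mod_cast hn)).norm.congr (Eventually.of_forall fun ξ => ?_)
    simp
  · rw [Real.iteratedDeriv_fourier (N := N) (fun n hn => hneg n (by exact_mod_cast hn)) le_rfl,
      ← fourierInv_eq_integral_cexp, Real.fourierInv_eq_fourier_comp_neg]
    refine congrArg (fun g : ℝ → ℂ => 𝓕 g x) (funext fun ξ => ?_)
    simp only [smul_eq_mul, freq, Complex.ofReal_neg]
    congr 2
    ring

/-- The Fourier transform of an absolutely integrable `C ^ M` function with absolutely integrable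
derivatives is bounded with decay of order `M`. -/
lemma exists_fourier_decay {f : ℝ → ℝ} {M : ℕ} (hf : ContDiff ℝ M f)
    (hfi : ∀ k ≤ M, Integrable (iteratedDeriv k f)) :
    ∃ C, (∀ ξ, ‖𝓕 (fun x => (f x : ℂ)) ξ‖ ≤ C) ∧
      ∀ ξ, |ξ| ^ M * ‖𝓕 (fun x => (f x : ℂ)) ξ‖ ≤ C := by
  have hfc : ContDiff ℝ M fun x => (f x : ℂ) := Complex.ofRealCLM.contDiff.comp hf
  have hit : ∀ k ≤ M, iteratedDeriv k (fun x => (f x : ℂ)) =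
      fun x => ((iteratedDeriv k f x : ℝ) : ℂ) := fun k hk => funext fun x =>
    iteratedDeriv_clm_comp Complex.ofRealCLM (hf.of_le (by exact_mod_cast hk)) x
  have hM := Real.fourier_iteratedDeriv (N := M) (n := M) hfc (fun k hk => by
    rw [hit k (by exact_mod_cast hk)]
    exact (hfi k (by exact_mod_cast hk)).ofReal) le_rfl
  refine ⟨max (∫ x, ‖(f x : ℂ)‖) (∫ x, ‖iteratedDeriv M (fun x => (f x : ℂ)) x‖),
    fun ξ => (norm_fourier_le _ ξ).trans (le_max_left _ _), fun ξ => ?_⟩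
  refine le_trans ?_ ((norm_fourier_le (iteratedDeriv M fun x => (f x : ℂ)) ξ).trans
    (le_max_right _ _))
  rw [hM, norm_smul, norm_pow]
  gcongr
  simp only [norm_mul, Complex.norm_I, Complex.norm_real, Complex.norm_ofNat, mul_one,
    Real.norm_eq_abs, abs_of_pos Real.pi_pos]
  have : 1 ≤ 2 * Real.pi := by linarith [Real.pi_gt_three]
  exact le_mul_of_one_le_left (abs_nonneg _) this

/-- The Riemann-Liouville integral as a Fourier multiplier. -/
lemma integral_rpow_mul_comp_sub {β : ℝ} (hβ0 : 0 < β) (hβ1 : β < 1) {f : ℝ → ℝ}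
    (hfc : Continuous f) (hfi : Integrable f) {F : ℝ → ℂ} (hFc : Continuous F)
    (hFi : Integrable F) (hFβ : Integrable fun ξ => |ξ| ^ (-β) * ‖F ξ‖)
    (hinv : ∀ x : ℝ, (f x : ℂ) = ∫ ξ, Complex.exp (freq ξ * x) * F ξ) (x : ℝ) :
    ((∫ t in Ioi (0 : ℝ), t ^ (β - 1) * f (x - t) : ℝ) : ℂ) =
      Real.Gamma β * ∫ ξ, Complex.exp (freq ξ * x) * (freq ξ ^ (-(β : ℂ)) * F ξ) := by
  have hfx : Continuous fun t => f (x - t) := by fun_prop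
  have hfxi : Integrable fun t => f (x - t) := hfi.comp_sub_left x
  -- The kernel `t^(β-1)` is not integrable at infinity, so Fubini is unavailable for the double
  -- integral itself. The factor `exp (-εt)` makes it absolutely convergent, and `ε → 0+` is taken
  -- on both sides by dominated convergence.
  have hreg : ∀ ε : ℝ, 0 < ε →
      ∫ t in Ioi (0 : ℝ), ((t ^ (β - 1) * f (x - t) : ℝ) : ℂ) * Complex.exp (-(ε : ℂ) * t) =
        ∫ ξ, Complex.exp (freq ξ * x) * F ξ *
          (Real.Gamma β * ((ε : ℂ) + freq ξ) ^ (-(β : ℂ))) := by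
    intro ε hε
    have h1 : ∀ t : ℝ, ((t ^ (β - 1) * f (x - t) : ℝ) : ℂ) * Complex.exp (-(ε : ℂ) * t) =
        ∫ ξ, (((t ^ (β - 1) : ℝ) : ℂ) * Complex.exp (-(ε : ℂ) * t)) *
          (Complex.exp (freq ξ * (x - t : ℝ)) * F ξ) := by
      intro t
      rw [integral_const_mul, ← hinv]
      push_cast
      ring
    simp only [h1]
    rw [integral_integral_swap]
    · congr 1
      ext ξ
      rw [← integral_rpow_mul_cexp hβ0 (by simpa using hε), ← integral_const_mul]
      congr 1
      ext t
      rw [show freq ξ * ((x - t : ℝ) : ℂ) = freq ξ * x + -freq ξ * t by push_cast; ring,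
        Complex.exp_add, show -((ε : ℂ) + freq ξ) * t = -(ε : ℂ) * t + -freq ξ * t by ring,
        Complex.exp_add]
      ring
    · have hI := (integrableOn_rpow_mul_cexp (b := β - 1) (by linarith) (z := (ε : ℂ))
        (by simpa using hε)).mul_prod hFi
      have hc : Continuous fun z : ℝ × ℝ => Complex.exp (freq z.2 * (x - z.1 : ℝ)) := by
        have := continuous_freq
        fun_prop
      refine (hI.bdd_mul (c := 1) hc.aestronglyMeasurable
        (Eventually.of_forall fun z => (norm_cexp_freq_mul _ _).le)).congr
        (Eventually.of_forall fun z => ?_)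
      simp only [Function.uncurry]
      ring
  have hlim1 : Tendsto (fun ε : ℝ => ∫ t in Ioi (0 : ℝ),
      ((t ^ (β - 1) * f (x - t) : ℝ) : ℂ) * Complex.exp (-(ε : ℂ) * t)) (𝓝[>] 0)
      (𝓝 (∫ t in Ioi (0 : ℝ), ((t ^ (β - 1) * f (x - t) : ℝ) : ℂ))) := by
    refine tendsto_integral_filter_of_dominated_convergence
      (fun t => ‖t ^ (β - 1) * f (x - t)‖) ?_ ?_
      (integrableOn_rpow_mul_of_continuous (by linarith) (by linarith) hfx hfxi).norm ?_
    · refine Eventually.of_forall fun ε => Measurable.aestronglyMeasurable ?_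
      have := hfx.measurable
      fun_prop
    · filter_upwards [self_mem_nhdsWithin] with ε hε
      filter_upwards [ae_restrict_mem measurableSet_Ioi] with t ht
      have hε' : (0 : ℝ) < ε := hε
      have ht' : (0 : ℝ) < t := ht
      rw [norm_mul, Complex.norm_real, Complex.norm_exp]
      refine mul_le_of_le_one_right (norm_nonneg _) (Real.exp_le_one_iff.2 ?_)
      simp only [neg_mul, Complex.neg_re, Complex.mul_re, Complex.ofReal_re, Complex.ofReal_im]
      nlinarith
    · refine Eventually.of_forall fun t => ?_
      have : Continuous fun ε : ℝ =>
          ((t ^ (β - 1) * f (x - t) : ℝ) : ℂ) * Complex.exp (-(ε : ℂ) * t) := by fun_prop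
      simpa using (this.tendsto 0).mono_left nhdsWithin_le_nhds
  have hne : ∀ᵐ ξ : ℝ, ξ ≠ 0 := by simp [ae_iff]
  have hlim2 : Tendsto (fun ε : ℝ => ∫ ξ, Complex.exp (freq ξ * x) * F ξ *
      (Real.Gamma β * ((ε : ℂ) + freq ξ) ^ (-(β : ℂ)))) (𝓝[>] 0)
      (𝓝 (∫ ξ, Complex.exp (freq ξ * x) * F ξ * (Real.Gamma β * freq ξ ^ (-(β : ℂ))))) := by
    have hG := Real.Gamma_pos_of_pos hβ0
    refine tendsto_integral_filter_of_dominated_convergence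
      (fun ξ => Real.Gamma β * (2 * Real.pi) ^ (-β) * (|ξ| ^ (-β) * ‖F ξ‖)) ?_ ?_
      (hFβ.const_mul _) ?_
    · refine Eventually.of_forall fun ε => Measurable.aestronglyMeasurable ?_
      have h1 := hFc.measurable
      have h2 := continuous_freq.measurable
      fun_prop
    · filter_upwards [self_mem_nhdsWithin] with ε hε
      filter_upwards [hne] with ξ hξ
      have hε' : (0 : ℝ) < ε := hε
      have hpos : 0 < ‖freq ξ‖ := norm_pos_iff.2 (freq_ne_zero hξ)
      -- `freq ξ` is purely imaginary, so adding a real number cannot decrease the norm; as the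
      -- exponent `-β` is negative, `‖freq ξ‖^(-β)` dominates for every `ε`.
      have hle : ‖freq ξ‖ ≤ ‖(ε : ℂ) + freq ξ‖ := by
        have h1 : ‖freq ξ‖ = |(freq ξ).im| := by
          rw [← Complex.abs_im_eq_norm.2 (freq_re ξ)]
        rw [h1, show (freq ξ).im = ((ε : ℂ) + freq ξ).im by simp]
        exact Complex.abs_im_le_norm _
      rw [norm_mul, norm_mul, norm_mul, norm_cexp_freq_mul, one_mul, Complex.norm_real,
        Real.norm_of_nonneg hG.le, ← Complex.ofReal_neg, Complex.norm_cpow_real]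
      have h2 : ‖(ε : ℂ) + freq ξ‖ ^ (-β) ≤ ‖freq ξ‖ ^ (-β) :=
        Real.rpow_le_rpow_of_nonpos hpos hle (by linarith)
      have h3 : ‖freq ξ‖ ^ (-β) = (2 * Real.pi) ^ (-β) * |ξ| ^ (-β) := by
        rw [norm_freq, Real.mul_rpow (by positivity) (abs_nonneg _)]
      rw [h3] at h2
      calc ‖F ξ‖ * (Real.Gamma β * ‖(ε : ℂ) + freq ξ‖ ^ (-β))
          ≤ ‖F ξ‖ * (Real.Gamma β * ((2 * Real.pi) ^ (-β) * |ξ| ^ (-β))) := by gcongr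
        _ = _ := by ring
    · filter_upwards [hne] with ξ hξ
      have h1 : Tendsto (fun ε : ℝ => (ε : ℂ) + freq ξ) (𝓝[>] 0) (𝓝 (freq ξ)) := by
        have : Continuous fun ε : ℝ => (ε : ℂ) + freq ξ := by fun_prop
        simpa using (this.tendsto 0).mono_left nhdsWithin_le_nhds
      exact ((h1.cpow tendsto_const_nhds (freq_mem_slitPlane hξ)).const_mul _).const_mul _
  have heq := tendsto_nhds_unique (hlim1.congr' (by
    filter_upwards [self_mem_nhdsWithin] with ε hε
    exact hreg ε hε)) hlim2
  rw [integral_complex_ofReal] at heq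
  rw [heq, ← integral_const_mul]
  congr 1
  ext ξ
  ring

lemma rlOrder_sub_pos {α : ℝ} : 0 < (rlOrder α : ℝ) - α := by
  have := Nat.lt_floor_add_one α
  rw [rlOrder]
  push_cast
  linarith

lemma rlOrder_sub_le_one {α : ℝ} (hα : 0 ≤ α) : (rlOrder α : ℝ) - α ≤ 1 := by
  have := Nat.floor_le hα
  rw [rlOrder]
  push_cast
  linarith

lemma left_kernel_eq (α : ℝ) (f : ℝ → ℝ) (y : ℝ) {t : ℝ} (ht : 0 < t) :
    f (y - t) / (y - (y - t)) ^ (α + 1 - (rlOrder α : ℝ)) =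
      t ^ ((rlOrder α : ℝ) - α - 1) * f (y - t) := by
  rw [sub_sub_cancel, div_eq_inv_mul, ← Real.rpow_neg ht.le]
  congr 2
  ring

lemma preimage_sub_left_Iio (y : ℝ) : (fun t => y - t) ⁻¹' Iio y = Ioi 0 := by
  ext t
  simp

lemma leftIntegral_eq (α : ℝ) (f : ℝ → ℝ) (y : ℝ) :
    leftIntegral α f y = ∫ t in Ioi (0 : ℝ), t ^ ((rlOrder α : ℝ) - α - 1) * f (y - t) := by
  rw [leftIntegral, ← (Measure.measurePreserving_sub_left volume y).setIntegral_preimage_emb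
    (MeasurableEquiv.subLeft y).measurableEmbedding, preimage_sub_left_Iio]
  exact setIntegral_congr_fun measurableSet_Ioi fun t ht => left_kernel_eq α f y ht

lemma integrableOn_left_kernel {α : ℝ} (hα : 0 ≤ α) {f : ℝ → ℝ} (hf : Continuous f)
    (hfi : Integrable f) (y : ℝ) :
    IntegrableOn (fun η => f η / (y - η) ^ (α + 1 - (rlOrder α : ℝ))) (Iio y) := by
  rw [← (Measure.measurePreserving_sub_left volume y).integrableOn_comp_preimage
    (MeasurableEquiv.subLeft y).measurableEmbedding, preimage_sub_left_Iio]
  have h1 := rlOrder_sub_pos (α := α)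
  have h2 := rlOrder_sub_le_one hα
  refine IntegrableOn.congr_fun (integrableOn_rpow_mul_of_continuous
    (b := (rlOrder α : ℝ) - α - 1) (g := fun t => f (y - t)) (by linarith) (by linarith)
    (by fun_prop) (hfi.comp_sub_left y)) ?_ measurableSet_Ioi
  intro t ht
  exact (left_kernel_eq α f y ht).symm

/-- The Fourier representation of the left Riemann-Liouville derivative. -/
lemma hasLeftRLDerivAt_of_fourier {α : ℝ} (hα : 0 < α) (hfrac : (rlOrder α : ℝ) - α < 1)
    {f : ℝ → ℝ} (hfc : Continuous f) (hfi : Integrable f) {F : ℝ → ℂ} (hFc : Continuous F)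
    (hFi : Integrable F) (hFβ : Integrable fun ξ => |ξ| ^ (α - (rlOrder α : ℝ)) * ‖F ξ‖)
    (hFα : Integrable fun ξ => |ξ| ^ α * ‖F ξ‖)
    (hinv : ∀ x : ℝ, (f x : ℂ) = ∫ ξ, Complex.exp (freq ξ * x) * F ξ) (x : ℝ) :
    HasLeftRLDerivAt α f (∫ ξ, Complex.exp (freq ξ * x) * (freq ξ ^ (α : ℂ) * F ξ)).re x := by
  set N := rlOrder α with hN
  set β : ℝ := (N : ℝ) - α with hβ
  have hβ0 : 0 < β := rlOrder_sub_pos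
  have hNβ : α - (N : ℝ) = -β := by ring
  rw [hNβ] at hFβ
  set H : ℝ → ℂ := fun ξ => freq ξ ^ (-(β : ℂ)) * F ξ with hH
  have hHm : Measurable H := by
    have h1 := hFc.measurable
    have h2 := continuous_freq.measurable
    fun_prop
  have hne : ∀ᵐ ξ : ℝ, ξ ≠ 0 := by simp [ae_iff]
  have hnormH : ∀ ξ, ‖H ξ‖ = (2 * Real.pi) ^ (-β) * (|ξ| ^ (-β) * ‖F ξ‖) := by
    intro ξ
    rw [hH, norm_mul, ← Complex.ofReal_neg, Complex.norm_cpow_real, norm_freq,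
      Real.mul_rpow (by positivity) (abs_nonneg _)]
    ring
  have hmom : ∀ n ≤ N, Integrable fun ξ : ℝ => (ξ : ℂ) ^ n * H ξ := by
    intro n hn
    refine ((hFβ.add hFα).const_mul ((2 * Real.pi) ^ (-β))).mono'
      (Measurable.aestronglyMeasurable (by fun_prop)) ?_
    filter_upwards [hne] with ξ hξ
    have hpos : 0 < |ξ| := abs_pos.2 hξ
    rw [norm_mul, hnormH, norm_pow, Complex.norm_real, Real.norm_eq_abs]
    -- The intermediate moments need only the two extreme weights: `-β` controls `|ξ| ≤ 1`, and `N -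
    -- β = α` controls `|ξ| ≥ 1`.
    have hle : |ξ| ^ n * |ξ| ^ (-β) ≤ |ξ| ^ (-β) + |ξ| ^ α := by
      rcases le_total |ξ| 1 with h | h
      · have h1 : |ξ| ^ n * |ξ| ^ (-β) ≤ |ξ| ^ (-β) :=
          mul_le_of_le_one_left (by positivity) (pow_le_one₀ hpos.le h)
        have h2 : 0 ≤ |ξ| ^ α := by positivity
        linarith
      · have h1 : |ξ| ^ n * |ξ| ^ (-β) ≤ |ξ| ^ N * |ξ| ^ (-β) := by gcongr
        have h2 : |ξ| ^ N * |ξ| ^ (-β) = |ξ| ^ α := by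
          rw [← Real.rpow_natCast, ← Real.rpow_add hpos]
          congr 1
          ring
        have h3 : 0 ≤ |ξ| ^ (-β) := by positivity
        linarith
    have h4 : 0 ≤ (2 * Real.pi) ^ (-β) * ‖F ξ‖ := by positivity
    calc |ξ| ^ n * ((2 * Real.pi) ^ (-β) * (|ξ| ^ (-β) * ‖F ξ‖))
        = (2 * Real.pi) ^ (-β) * ‖F ξ‖ * (|ξ| ^ n * |ξ| ^ (-β)) := by ring
      _ ≤ (2 * Real.pi) ^ (-β) * ‖F ξ‖ * (|ξ| ^ (-β) + |ξ| ^ α) := by gcongr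
      _ = _ := by simp only [Pi.add_apply]; ring
  obtain ⟨hCD, hID⟩ := contDiff_fourierInv hmom
  have hG := Real.Gamma_pos_of_pos hβ0
  have hleft : leftIntegral α f = fun y => Real.Gamma β * Complex.reCLM (𝓕⁻ H y) := by
    ext y
    have h := integral_rpow_mul_comp_sub hβ0 hfrac hfc hfi hFc hFi hFβ hinv y
    rw [← fourierInv_eq_integral_cexp] at h
    rw [leftIntegral_eq, ← Complex.ofReal_re (∫ t in Ioi (0 : ℝ), _), h, Complex.re_ofReal_mul]
    rfl
  have hCDre : ContDiff ℝ N fun y => Complex.reCLM (𝓕⁻ H y) := Complex.reCLM.contDiff.comp hCD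
  refine ⟨integrableOn_left_kernel hα.le hfc hfi, ?_, ?_⟩
  · rw [hleft]
    exact (contDiff_const.mul hCDre).contDiffAt
  · rw [hleft, ← hN, iteratedDeriv_const_mul_field, iteratedDeriv_clm_comp _ hCD, hID,
      ← mul_assoc, one_div_mul_cancel hG.ne', one_mul, Complex.reCLM_apply]
    congr 1
    refine integral_congr_ae ?_
    filter_upwards [hne] with ξ hξ
    rw [hH]
    simp only
    rw [← mul_assoc (freq ξ ^ N), ← Complex.cpow_natCast, ← Complex.cpow_add _ _ (freq_ne_zero hξ)]
    congr 3
    rw [hβ]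
    push_cast
    ring

/-- The Fourier representation of the Grünwald type operator. -/
lemma hasSum_left_shifts {w : ℕ → ℝ} (hw : Summable fun k => |w k|) {f : ℝ → ℝ} {F : ℝ → ℂ}
    (hFi : Integrable F)
    (hinv : ∀ x : ℝ, (f x : ℂ) = ∫ ξ, Complex.exp (freq ξ * x) * F ξ) (r h x : ℝ) :
    HasSum (fun k : ℕ => ((w k * f (x - ((k : ℝ) - r) * h) : ℝ) : ℂ))
      (∫ ξ, Complex.exp (freq ξ * x) *
        (expSeries w (h * freq ξ) * Complex.exp (r * (h * freq ξ)) * F ξ)) := by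
  have hm : ∀ y : ℝ, Continuous fun ξ => Complex.exp (freq ξ * y) := by
    have := continuous_freq
    fun_prop
  have h1 : ∀ y : ℝ, Integrable fun ξ => Complex.exp (freq ξ * y) * F ξ := fun y =>
    hFi.bdd_mul (c := 1) (hm y).aestronglyMeasurable
      (Eventually.of_forall fun ξ => (norm_cexp_freq_mul ξ y).le)
  have key := hasSum_integral_of_summable_integral_norm (μ := volume)
    (F := fun (k : ℕ) ξ => (w k : ℂ) * (Complex.exp (freq ξ * (x - ((k : ℝ) - r) * h : ℝ)) * F ξ))
    (fun k => (h1 _).const_mul _) (by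
      simp only [norm_mul, norm_cexp_freq_mul, one_mul, Complex.norm_real, Real.norm_eq_abs]
      simp only [integral_const_mul]
      exact hw.mul_right _)
  convert! key using 1
  · ext k
    rw [integral_const_mul, ← hinv]
    push_cast
    rfl
  · congr 1
    ext ξ
    rw [expSeries, ← tsum_mul_right, ← tsum_mul_right, ← tsum_mul_left]
    congr 1
    ext k
    rw [show freq ξ * ((x - ((k : ℝ) - r) * h : ℝ) : ℂ) =
      freq ξ * x + (-(k : ℂ) * (h * freq ξ) + r * (h * freq ξ)) by push_cast; ring,
      Complex.exp_add, Complex.exp_add]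
    ring

lemma ofReal_mul_cpow {h : ℝ} (hh : 0 < h) {z : ℂ} (hz : z ≠ 0) (α : ℝ) :
    ((h : ℂ) * z) ^ (α : ℂ) = ((h ^ α : ℝ) : ℂ) * z ^ (α : ℂ) := by
  have hh' : (h : ℂ) ≠ 0 := by exact_mod_cast hh.ne'
  rw [mul_cpow_of_arg_add_mem hh' hz, Complex.ofReal_cpow hh.le]
  rw [Complex.arg_ofReal_of_nonneg hh.le, zero_add]
  exact Complex.arg_mem_Ioc z

/-! ### Convergence for non-integral orders -/

/-- The left approximation result for non-integral orders. -/
lemma approximatesLeft_of_lt {α : ℝ} (hα : 0 < α) {r : ℝ} {p : ℕ} (hp : 1 ≤ p) {w : ℕ → ℝ}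
    (hw : IsGeneratedBy w (genW α r p)) {m n : ℕ} (hn : (n : ℝ) - 1 < α) (hn' : α < n)
    (hpm : p ≤ m) {f : ℝ → ℝ} (hf : ContDiff ℝ ((m + n + 1 : ℕ) : WithTop ℕ∞) f)
    (hfi : ∀ k : ℕ, k ≤ m + n + 1 → Integrable (iteratedDeriv k f)) (x : ℝ) :
    ApproximatesLeft w α r p f x := by
  have hfl : ⌊α⌋₊ = n - 1 := by
    have hn1 : 1 ≤ n := by
      by_contra! h0
      have : n = 0 := by omega
      subst this
      norm_num at hn'
      linarith
    rw [Nat.floor_eq_iff hα.le]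
    push_cast [Nat.cast_sub hn1]
    constructor <;> linarith
  have hN : rlOrder α = n := by
    have hn1 : n ≠ 0 := by
      rintro rfl
      norm_num at hn'
      linarith
    rw [rlOrder, hfl]
    omega
  have hfi0 : Integrable f := by simpa using hfi 0 (Nat.zero_le _)
  set F := 𝓕 (fun x => (f x : ℂ)) with hF
  have hFc : Continuous F := continuous_fourier_of_integrable hfi0.ofReal
  obtain ⟨C, hC0, hCM⟩ := exists_fourier_decay hf hfi
  -- The decay has order `M = m + n + 1`, whence the limit `a < M - 1 = m + n`. The largest exponent
  -- used is `α + p`, which is below it because `α < n` and `p ≤ m`.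
  have hint : ∀ a : ℝ, -1 < a → a < (m : ℝ) + n → Integrable fun ξ => |ξ| ^ a * ‖F ξ‖ :=
    fun a h1 h2 => integrable_abs_rpow_mul_norm hFc hC0 hCM h1 (by push_cast; linarith)
  have hp' : (1 : ℝ) ≤ p := by exact_mod_cast hp
  have hpm' : (p : ℝ) ≤ m := by exact_mod_cast hpm
  have hFi : Integrable F := by
    have h := hint 0 (by norm_num) (by linarith)
    simp only [Real.rpow_zero, one_mul] at h
    exact (integrable_norm_iff hFc.aestronglyMeasurable).1 h
  have hinv : ∀ x : ℝ, (f x : ℂ) = ∫ ξ, Complex.exp (freq ξ * x) * F ξ := by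
    intro y
    rw [← fourierInv_eq_integral_cexp, hF, Continuous.fourierInv_fourier_eq _ hfi0.ofReal hFi]
    exact Complex.continuous_ofReal.comp hf.continuous
  have hsum := hasSum_left_shifts hw.summable_abs hFi hinv r
  refine ⟨fun h _ => ?_, _, hasLeftRLDerivAt_of_fourier hα (by rw [hN]; linarith) hf.continuous
    hfi0 hFc hFi (hint _ (by rw [hN]; linarith) (by rw [hN]; linarith))
    (hint α (by linarith) (by linarith)) hinv x, ?_⟩
  · exact Complex.summable_ofReal.1 (hsum h x).summable
  obtain ⟨B, hB⟩ := exists_expSeries_sub_cpow_le_of_re_eq_zero hα hp hw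
  have hFαp := hint (α + p) (by linarith) (by linarith)
  -- The symbol estimate at `h * freq ξ` has size `B (2πh|ξ|)^(α+p)`; dividing by `h^α` leaves
  -- `h^p`, and integration against `‖F ξ‖` gives this constant.
  refine IsBigO.of_bound (B * (2 * Real.pi) ^ (α + p) * ∫ ξ, |ξ| ^ (α + p) * ‖F ξ‖) ?_
  filter_upwards [self_mem_nhdsWithin] with h hh
  have hh0 : 0 < h := hh
  have hhα : 0 < h ^ α := by positivity
  have hm : Continuous fun ξ => Complex.exp (freq ξ * x) := by
    have := continuous_freq
    fun_prop
  set S : ℝ → ℂ := fun ξ => expSeries w (h * freq ξ) * Complex.exp (r * (h * freq ξ)) with hS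
  have hdelta : leftDelta w α r h f x =
      (∫ ξ, ((1 / h ^ α : ℝ) : ℂ) * (Complex.exp (freq ξ * x) * (S ξ * F ξ))).re := by
    rw [integral_const_mul, Complex.re_ofReal_mul, leftDelta, ← (hsum h x).tsum_eq,
      ← Complex.ofReal_tsum, Complex.ofReal_re]
  have hne : ∀ᵐ ξ : ℝ, ξ ≠ 0 := by simp [ae_iff]
  have hfreqc := continuous_freq
  have hScont : Continuous S := by
    have h1 : Continuous fun ξ => expSeries w (h * freq ξ) :=
      (continuousOn_expSeries hw.summable_abs).comp_continuous (by fun_prop)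
        (fun ξ => by simp [Complex.mul_re])
    fun_prop
  have hSbd : ∀ ξ, ‖S ξ‖ ≤ ∑' k, |w k| := by
    intro ξ
    rw [hS, norm_mul, Complex.norm_exp]
    simpa [Complex.mul_re] using norm_expSeries_le hw.summable_abs (z := h * freq ξ)
      (by simp [Complex.mul_re])
  have hi1 : Integrable fun ξ => Complex.exp (freq ξ * x) * (freq ξ ^ (α : ℂ) * F ξ) := by
    refine (((hint α (by linarith) (by linarith)).const_mul ((2 * Real.pi) ^ α))).mono'
      (Measurable.aestronglyMeasurable ?_) (Eventually.of_forall fun ξ => ?_)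
    · have h1 := hFc.measurable
      have h2 := continuous_freq.measurable
      fun_prop
    · rw [norm_mul, norm_cexp_freq_mul, one_mul, norm_mul, Complex.norm_cpow_real, norm_freq,
        Real.mul_rpow (by positivity) (abs_nonneg _), mul_assoc]
  have hi2 : Integrable fun ξ => ((1 / h ^ α : ℝ) : ℂ) *
      (Complex.exp (freq ξ * x) * (S ξ * F ξ)) := by
    refine Integrable.const_mul ?_ _
    refine Integrable.bdd_mul (c := 1) ?_ hm.aestronglyMeasurable
      (Eventually.of_forall fun ξ => (norm_cexp_freq_mul ξ x).le)
    exact hFi.bdd_mul hScont.aestronglyMeasurable (Eventually.of_forall hSbd)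
  rw [hdelta, ← Complex.sub_re, ← integral_sub hi1 hi2]
  refine (Complex.abs_re_le_norm _).trans ?_
  rw [norm_pow, Real.norm_of_nonneg hh0.le, mul_right_comm, ← integral_const_mul]
  refine norm_integral_le_of_norm_le (hFαp.const_mul _) ?_
  filter_upwards [hne] with ξ hξ
  have hs := freq_ne_zero hξ
  have hB' := hB (h * freq ξ) (by simp [Complex.mul_re])
    (mul_ne_zero (by exact_mod_cast hh0.ne') hs)
  rw [ofReal_mul_cpow hh0 hs, norm_mul, Complex.norm_real, Real.norm_of_nonneg hh0.le, norm_freq,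
    Real.mul_rpow hh0.le (by positivity), Real.mul_rpow (by positivity) (abs_nonneg _)] at hB'
  have hhα' : ((h ^ α : ℝ) : ℂ) ≠ 0 := by exact_mod_cast hhα.ne'
  have hfac : Complex.exp (freq ξ * x) * (freq ξ ^ (α : ℂ) * F ξ) -
      ((1 / h ^ α : ℝ) : ℂ) * (Complex.exp (freq ξ * x) * (S ξ * F ξ)) =
      -(((1 / h ^ α : ℝ) : ℂ) * (Complex.exp (freq ξ * x) *
        ((S ξ - ((h ^ α : ℝ) : ℂ) * freq ξ ^ (α : ℂ)) * F ξ))) := by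
    rw [Complex.ofReal_div, Complex.ofReal_one]
    field_simp
    ring
  rw [hfac, norm_neg, norm_mul, norm_mul, norm_mul, norm_cexp_freq_mul, one_mul,
    Complex.norm_real, Real.norm_of_nonneg (by positivity)]
  calc 1 / h ^ α * (‖S ξ - ((h ^ α : ℝ) : ℂ) * freq ξ ^ (α : ℂ)‖ * ‖F ξ‖)
      ≤ 1 / h ^ α * ((B * (h ^ (α + p) * ((2 * Real.pi) ^ (α + p) * |ξ| ^ (α + p)))) * ‖F ξ‖) := by
        gcongr
    _ = B * (2 * Real.pi) ^ (α + p) * h ^ p * (|ξ| ^ (α + p) * ‖F ξ‖) := by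
        rw [Real.rpow_add hh0, Real.rpow_natCast]
        field_simp

/-! ### Integral orders: moments and identification of the weights -/

section PowerSeries

open PowerSeries

/-- The formal exponential `exp (a X)`. -/
noncomputable def formalExp (a : ℝ) : PowerSeries ℝ := rescale a (exp ℝ)

lemma coeff_formalExp (a : ℝ) (j : ℕ) : coeff j (formalExp a) = a ^ j / j.factorial := by
  simp [formalExp, coeff_rescale, coeff_exp, div_eq_mul_inv]

lemma formalExp_add (a b : ℝ) : formalExp (a + b) = formalExp a * formalExp b :=
  (exp_mul_exp_eq_exp_add a b).symm

lemma formalExp_pow (a : ℝ) (k : ℕ) : formalExp a ^ k = formalExp (k * a) := by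
  induction k with
  | zero =>
    ext j
    rw [coeff_formalExp, pow_zero, coeff_one]
    rcases eq_or_ne j 0 with rfl | h <;> simp [*]
  | succ k ih =>
    rw [pow_succ, ih, ← formalExp_add]
    congr 1
    push_cast
    ring

/-- With `S = exp ((r/n) X) P(exp (-X))` as a formal series, the Lagrange moments give `S = X (1 +
O(X^p))`, hence `S^n = X^n + O(X^(n+p))`. Expanding `S^n` instead as a sum of exponentials `exp ((r
- k) X)` and comparing coefficients of `X^j` gives the moments. -/
lemma sum_coeff_pow_mul_sub_pow {r : ℝ} {p n : ℕ} (hn : n ≠ 0) {K : ℕ}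
    (hK : (basePoly (n : ℝ) r p ^ n).natDegree < K) {j : ℕ} (hj : j < n + p) :
    ∑ k ∈ Finset.range K, (basePoly (n : ℝ) r p ^ n).coeff k * (r - k) ^ j =
      if j = n then (n.factorial : ℝ) else 0 := by
  have hn' : (n : ℝ) ≠ 0 := by exact_mod_cast hn
  set P := basePoly (n : ℝ) r p with hP
  set S : PowerSeries ℝ := formalExp (r / n) * Polynomial.aeval (formalExp (-1)) P with hS
  have hScoeff : ∀ i ≤ p, coeff i S = if i = 1 then 1 else 0 := by
    intro i hi
    have h1 : S = ∑ j ∈ Finset.range (p + 1), beta (r / n) p j • formalExp (r / n - j) := by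
      rw [hS, hP, basePoly, map_sum, Finset.mul_sum]
      refine Finset.sum_congr rfl fun j _ => ?_
      rw [Polynomial.aeval_monomial, formalExp_pow, ← Algebra.smul_def, mul_smul_comm,
        ← formalExp_add]
      congr 2
      ring
    have h2 := sum_beta_mul_sub_pow (r / n) p i hi
    have h3 : coeff i S = (∑ j ∈ Finset.range (p + 1),
        beta (r / n) p j * (r / n - j) ^ i) / i.factorial := by
      rw [h1, map_sum, Finset.sum_div]
      refine Finset.sum_congr rfl fun j _ => ?_
      rw [coeff_smul, coeff_formalExp, smul_eq_mul, mul_div_assoc]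
    rw [h3, h2]
    split_ifs with h
    · simp [h]
    · simp
  obtain ⟨T, hT⟩ : X ∣ S := by
    rw [X_dvd_iff, ← coeff_zero_eq_constantCoeff_apply, hScoeff 0 (Nat.zero_le _)]
    simp
  have hT1 : X ^ p ∣ T - 1 := by
    rw [X_pow_dvd_iff]
    intro i hi
    have h := hScoeff (i + 1) hi
    rw [hT, coeff_succ_X_mul] at h
    rw [map_sub, h, coeff_one]
    simp
  obtain ⟨V, hV⟩ : X ^ p ∣ T ^ n - 1 := by
    have := sub_dvd_pow_sub_pow T 1 n
    rw [one_pow] at this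
    exact hT1.trans this
  have hSn : S ^ n = X ^ n + X ^ (n + p) * V := by
    rw [hT, mul_pow, pow_add, mul_assoc, ← hV]
    ring
  have hSn' : S ^ n = ∑ k ∈ Finset.range K, (P ^ n).coeff k • formalExp (r - k) := by
    rw [hS, mul_pow, ← map_pow, formalExp_pow, Polynomial.aeval_eq_sum_range' hK, Finset.mul_sum]
    refine Finset.sum_congr rfl fun k _ => ?_
    rw [formalExp_pow, mul_smul_comm, ← formalExp_add]
    congr 2
    field_simp
    ring
  have hc := congrArg (coeff j) (hSn'.symm.trans hSn)
  rw [map_sum, map_add, coeff_X_pow, coeff_X_pow_mul', if_neg (by omega : ¬ n + p ≤ j),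
    add_zero] at hc
  have hjf : (j.factorial : ℝ) ≠ 0 := by exact_mod_cast j.factorial_ne_zero
  have hc' : (∑ k ∈ Finset.range K, (P ^ n).coeff k * (r - k) ^ j) / j.factorial =
      if j = n then 1 else 0 := by
    rw [← hc, Finset.sum_div]
    refine Finset.sum_congr rfl fun k _ => ?_
    rw [coeff_smul, coeff_formalExp, smul_eq_mul, mul_div_assoc]
  rw [div_eq_iff hjf] at hc'
  rw [hc']
  split_ifs with h
  · rw [h, one_mul]
  · rw [zero_mul]

end PowerSeries

/-- Absolute summability makes the sum continuous on `[0, 1]`, so `x → 0+` annihilates the constant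
term; dividing by `x` passes to the shifted sequence. Quantifying over `d` inside lets the induction
apply to that shift. -/
lemma eq_zero_of_hasSum_pow_zero (k : ℕ) : ∀ d : ℕ → ℝ, (Summable fun k => |d k|) →
    (∀ x ∈ Ioo (0 : ℝ) 1, HasSum (fun k => d k * x ^ k) 0) → d k = 0 := by
  have hzero : ∀ d : ℕ → ℝ, (Summable fun k => |d k|) →
      (∀ x ∈ Ioo (0 : ℝ) 1, HasSum (fun k => d k * x ^ k) 0) → d 0 = 0 := by
    intro d hd h
    have hc : ContinuousOn (fun x : ℝ => ∑' k, d k * x ^ k) (Icc 0 1) := by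
      refine continuousOn_tsum (fun k => by fun_prop) hd fun k x hx => ?_
      rw [norm_mul, norm_pow, Real.norm_of_nonneg hx.1, Real.norm_eq_abs]
      exact mul_le_of_le_one_right (abs_nonneg _) (pow_le_one₀ hx.1 hx.2)
    have h0 : ∑' k, d k * (0 : ℝ) ^ k = d 0 := by
      rw [tsum_eq_single 0 (fun k hk => by simp [hk])]
      simp
    have h1 := hc 0 (by simp)
    have hsub : Ioo (0 : ℝ) 1 ⊆ Icc 0 1 := Ioo_subset_Icc_self
    have h2 : Tendsto (fun x : ℝ => ∑' k, d k * x ^ k) (𝓝[Ioo 0 1] 0) (𝓝 (d 0)) := by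
      rw [← h0]
      exact h1.mono_left (nhdsWithin_mono _ hsub)
    have hne : (𝓝[Ioo (0 : ℝ) 1] 0).NeBot := by
      rw [nhdsWithin_Ioo_eq_nhdsGT one_pos]
      infer_instance
    refine tendsto_nhds_unique (h2.congr' ?_) tendsto_const_nhds
    filter_upwards [self_mem_nhdsWithin] with x hx
    exact (h x hx).tsum_eq
  induction k with
  | zero => exact hzero
  | succ k ih =>
    intro d hd h
    refine ih (fun k => d (k + 1)) ((summable_nat_add_iff 1).2 hd) fun x hx => ?_
    have h1 := (hasSum_nat_add_iff' 1).2 (h x hx)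
    have h2 := h1.mul_left x⁻¹
    have hx0 : x ≠ 0 := hx.1.ne'
    convert! h2 using 1
    · ext k
      field_simp
      ring
    · simp [hzero d hd h]

lemma eq_coeff_pow_of_isGeneratedBy {r : ℝ} {p n : ℕ} {w : ℕ → ℝ}
    (hw : IsGeneratedBy w (genW (n : ℝ) r p)) (k : ℕ) :
    w k = (basePoly (n : ℝ) r p ^ n).coeff k := by
  set Q := basePoly (n : ℝ) r p ^ n with hQ
  have hfin : ∀ i, i ∉ Finset.range (Q.natDegree + 1) → Q.coeff i = 0 := fun i hi =>
    Polynomial.coeff_eq_zero_of_natDegree_lt (by simpa [Nat.lt_succ_iff] using hi)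
  have hsum : Summable fun i => |Q.coeff i| :=
    summable_of_ne_finset_zero (s := Finset.range (Q.natDegree + 1)) fun i hi => by
      rw [hfin i hi, abs_zero]
  refine sub_eq_zero.1 (eq_zero_of_hasSum_pow_zero k (fun i => w i - Q.coeff i) ?_ ?_)
  · exact (hw.summable_abs.add hsum).of_nonneg_of_le (fun i => abs_nonneg _)
      fun i => abs_sub _ _
  · intro x hx
    have h1 := hw.hasSum x ⟨hx.1.le, hx.2⟩
    have h2 : HasSum (fun i => Q.coeff i * x ^ i) (Q.eval x) := by
      rw [Polynomial.eval_eq_sum_range]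
      exact hasSum_sum_of_ne_finset_zero fun i hi => by rw [hfin i hi, zero_mul]
    have h3 := h1.sub h2
    rw [genW, Real.rpow_natCast, hQ, Polynomial.eval_pow, sub_self] at h3
    simpa only [sub_mul] using h3

/-! ### Convergence for integral orders -/

lemma hasDerivAt_integral_Iio {f : ℝ → ℝ} (hf : Continuous f) (hfi : Integrable f) (x : ℝ) :
    HasDerivAt (fun y => ∫ t in Iio y, f t) (f x) x := by
  have h : (fun y => ∫ t in Iio y, f t) =
      fun y => (∫ t in Iic (0 : ℝ), f t) + ∫ t in (0 : ℝ)..y, f t := by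
    ext y
    rw [← integral_Iic_eq_integral_Iio, ← intervalIntegral.integral_Iic_sub_Iic
      hfi.integrableOn hfi.integrableOn]
    ring
  rw [h]
  exact (hf.integral_hasStrictDerivAt 0 x).hasDerivAt.const_add _

lemma rlOrder_natCast (n : ℕ) : rlOrder (n : ℝ) = n + 1 := by
  simp [rlOrder]

/-- For `α = n` the Riemann-Liouville order is `n + 1`, the kernel exponent is zero and the Gamma
factor is `Γ(1) = 1`: the integral is a primitive of `f`, and one of the `n + 1` derivatives undoes
it. -/
lemma hasLeftRLDerivAt_natCast {n : ℕ} {f : ℝ → ℝ} (hf : ContDiff ℝ n f) (hfi : Integrable f)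
    (x : ℝ) : HasLeftRLDerivAt n f (iteratedDeriv n f x) x := by
  have hI : leftIntegral n f = fun y => ∫ t in Iio y, f t := by
    ext y
    simp [leftIntegral, rlOrder_natCast]
  have hd := fun y => hasDerivAt_integral_Iio hf.continuous hfi y
  have hderiv : deriv (fun y => ∫ t in Iio y, f t) = f := funext fun y => (hd y).deriv
  refine ⟨integrableOn_left_kernel n.cast_nonneg hf.continuous hfi, ?_, ?_⟩
  · rw [hI, rlOrder_natCast]
    refine ContDiff.contDiffAt ?_
    push_cast
    rw [contDiff_succ_iff_deriv, hderiv]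
    exact ⟨fun y => (hd y).differentiableAt, by simp, hf⟩
  · rw [hI, rlOrder_natCast, iteratedDeriv_succ', hderiv]
    simp

/-- The left approximation result for integral orders. -/
lemma approximatesLeft_natCast {n : ℕ} (hn : n ≠ 0) {r : ℝ} {p : ℕ} (hp : 1 ≤ p) {w : ℕ → ℝ}
    (hw : IsGeneratedBy w (genW (n : ℝ) r p)) {f : ℝ → ℝ}
    (hf : ContDiff ℝ ((n + p : ℕ) : WithTop ℕ∞) f) (hfi : Integrable f) (x : ℝ) :
    ApproximatesLeft w n r p f x := by
  set Q := basePoly (n : ℝ) r p ^ n with hQ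
  set K := Q.natDegree + 1 with hK
  have hwQ : ∀ k, w k = Q.coeff k := eq_coeff_pow_of_isGeneratedBy hw
  have hw0 : ∀ k, k ∉ Finset.range K → w k = 0 := fun k hk => by
    rw [hwQ]
    exact Polynomial.coeff_eq_zero_of_natDegree_lt (by simpa [hK, Nat.lt_succ_iff] using hk)
  refine ⟨fun h _ => summable_of_ne_finset_zero (s := Finset.range K) fun k hk => by
    rw [hw0 k hk, zero_mul], _, hasLeftRLDerivAt_natCast
      (hf.of_le (by exact_mod_cast Nat.le_add_right n p)) hfi x, ?_⟩
  have htaylor : (fun y => f y - taylorWithinEval f (n + p) univ x y) =O[𝓝 x]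
      fun y => (y - x) ^ (n + p) := (taylor_isLittleO_univ hf).isBigO
  have hterm : ∀ k : ℕ, (fun h : ℝ => f (x - ((k : ℝ) - r) * h) -
      taylorWithinEval f (n + p) univ x (x - ((k : ℝ) - r) * h)) =O[𝓝 0]
      fun h : ℝ => h ^ (n + p) := by
    intro k
    have ht : Tendsto (fun h : ℝ => x - ((k : ℝ) - r) * h) (𝓝 0) (𝓝 x) := by
      have : Continuous fun h : ℝ => x - ((k : ℝ) - r) * h := by fun_prop
      simpa using this.tendsto 0
    refine (htaylor.comp_tendsto ht).trans ?_
    simp only [Function.comp_def, sub_sub_cancel_left]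
    simp only [← neg_mul, mul_pow]
    exact IsBigO.const_mul_left (isBigO_refl _ _) _
  -- The moments are known only for `j < n + p`. The top Taylor term keeps its unevaluated moment,
  -- since it already carries `h^(n+p)`.
  have hpoly : ∀ h : ℝ, ∑ k ∈ Finset.range K, w k *
      taylorWithinEval f (n + p) univ x (x - ((k : ℝ) - r) * h) =
      iteratedDeriv n f x * h ^ n + (((n + p).factorial : ℝ)⁻¹ * iteratedDeriv (n + p) f x *
        ∑ k ∈ Finset.range K, w k * (r - k) ^ (n + p)) * h ^ (n + p) := by
    intro h
    have h1 : ∀ k : ℕ, taylorWithinEval f (n + p) univ x (x - ((k : ℝ) - r) * h) =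
        ∑ j ∈ Finset.range (n + p + 1),
          ((j.factorial : ℝ)⁻¹ * iteratedDeriv j f x * h ^ j) * (r - k) ^ j := by
      intro k
      rw [taylor_within_apply]
      refine Finset.sum_congr rfl fun j _ => ?_
      rw [iteratedDerivWithin_univ, smul_eq_mul,
        show x - ((k : ℝ) - r) * h - x = (r - k) * h by ring, mul_pow]
      ring
    have h2 : ∀ j ∈ Finset.range (n + p), ((j.factorial : ℝ)⁻¹ * iteratedDeriv j f x * h ^ j) *
        (∑ k ∈ Finset.range K, w k * (r - k) ^ j) =
        if j = n then iteratedDeriv n f x * h ^ n else 0 := by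
      intro j hj
      simp only [hwQ]
      rw [sum_coeff_pow_mul_sub_pow hn (Nat.lt_succ_self _) (Finset.mem_range.1 hj)]
      split_ifs with hjn
      · subst hjn
        have : (j.factorial : ℝ) ≠ 0 := by exact_mod_cast j.factorial_ne_zero
        field_simp
      · rw [mul_zero]
    calc ∑ k ∈ Finset.range K, w k *
        taylorWithinEval f (n + p) univ x (x - ((k : ℝ) - r) * h)
        = ∑ j ∈ Finset.range (n + p + 1), ((j.factorial : ℝ)⁻¹ * iteratedDeriv j f x * h ^ j) *
          (∑ k ∈ Finset.range K, w k * (r - k) ^ j) := by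
          simp only [h1, Finset.mul_sum]
          rw [Finset.sum_comm]
          refine Finset.sum_congr rfl fun j _ => Finset.sum_congr rfl fun k _ => ?_
          ring
      _ = _ := by
          rw [Finset.sum_range_succ, Finset.sum_congr rfl h2, Finset.sum_ite_eq',
            if_pos (by simp; omega)]
          ring
  have hmain : (fun h : ℝ => ∑ k ∈ Finset.range K, w k * f (x - ((k : ℝ) - r) * h) -
      iteratedDeriv n f x * h ^ n) =O[𝓝 0] fun h : ℝ => h ^ (n + p) := by
    have h1 : (fun h : ℝ => ∑ k ∈ Finset.range K, w k * (f (x - ((k : ℝ) - r) * h) -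
        taylorWithinEval f (n + p) univ x (x - ((k : ℝ) - r) * h))) =O[𝓝 0]
        fun h : ℝ => h ^ (n + p) :=
      IsBigO.fun_sum fun k _ => (hterm k).const_mul_left (w k)
    have h2 := h1.add (IsBigO.const_mul_left (isBigO_refl (fun h : ℝ => h ^ (n + p)) (𝓝 0))
      (((n + p).factorial : ℝ)⁻¹ * iteratedDeriv (n + p) f x *
        ∑ k ∈ Finset.range K, w k * (r - k) ^ (n + p)))
    refine h2.congr_left fun h => ?_
    simp only [mul_sub, Finset.sum_sub_distrib, hpoly]
    ring
  obtain ⟨C, hC⟩ := hmain.bound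
  refine IsBigO.of_bound C ?_
  filter_upwards [nhdsWithin_le_nhds hC, self_mem_nhdsWithin] with h hCh hh
  have hh0 : (0 : ℝ) < h := hh
  have hhn : 0 < h ^ n := by positivity
  have hd : leftDelta w n r h f x =
      1 / h ^ n * ∑ k ∈ Finset.range K, w k * f (x - ((k : ℝ) - r) * h) := by
    rw [leftDelta, Real.rpow_natCast, tsum_eq_sum fun k hk => by rw [hw0 k hk, zero_mul]]
  have hfac : iteratedDeriv n f x - leftDelta w n r h f x =
      -(1 / h ^ n * (∑ k ∈ Finset.range K, w k * f (x - ((k : ℝ) - r) * h) -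
        iteratedDeriv n f x * h ^ n)) := by
    rw [hd, mul_sub, mul_comm (iteratedDeriv n f x), ← mul_assoc, one_div_mul_cancel hhn.ne']
    ring
  rw [hfac, norm_neg, norm_mul, Real.norm_of_nonneg (by positivity : 0 ≤ 1 / h ^ n)]
  rw [norm_pow, Real.norm_of_nonneg hh0.le] at hCh ⊢
  calc 1 / h ^ n * _ ≤ 1 / h ^ n * (C * h ^ (n + p)) := by gcongr
    _ = C * h ^ p := by
      rw [pow_add]
      field_simp

/-! ### Reflection to the right derivative -/

lemma rightIntegral_eq (α : ℝ) (f : ℝ → ℝ) (y : ℝ) :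
    rightIntegral α f y = leftIntegral α (fun t => f (-t)) (-y) := by
  rw [rightIntegral, leftIntegral, ← (Measure.measurePreserving_neg volume).setIntegral_preimage_emb
    (MeasurableEquiv.neg ℝ).measurableEmbedding]
  have : Neg.neg ⁻¹' Ioi y = Iio (-y) := by
    ext t
    simp
  rw [this]
  refine setIntegral_congr_fun measurableSet_Iio fun t _ => ?_
  rw [show -t - y = -y - t by ring]

/-- Reflection exchanges the left and the right problem. -/
lemma approximatesRight_of_left_comp_neg {w : ℕ → ℝ} {α r : ℝ} {p : ℕ} {f : ℝ → ℝ} {x : ℝ}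
    (h : ApproximatesLeft w α r p (fun t => f (-t)) (-x)) : ApproximatesRight w α r p f x := by
  obtain ⟨hs, d, hd, hO⟩ := h
  have harg : ∀ (k : ℕ) (h : ℝ), -(-x - ((k : ℝ) - r) * h) = x + ((k : ℝ) - r) * h := by
    intro k h
    ring
  have hI : rightIntegral α f = fun y => leftIntegral α (fun t => f (-t)) (-y) :=
    funext (rightIntegral_eq α f)
  refine ⟨fun h hh => by simpa only [harg] using hs h hh, d, ⟨fun y => ?_, ?_, ?_⟩, ?_⟩
  · have h1 := hd.integrable (-y)
    rw [← (Measure.measurePreserving_neg volume).integrableOn_comp_preimage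
      (MeasurableEquiv.neg ℝ).measurableEmbedding]
    have : Neg.neg ⁻¹' Ioi y = Iio (-y) := by
      ext t
      simp
    rw [this]
    refine h1.congr_fun (fun t _ => ?_) measurableSet_Iio
    simp only [Function.comp_def]
    rw [show -t - y = -y - t by ring]
  · rw [hI]
    exact hd.contDiffAt.comp x contDiff_neg.contDiffAt
  -- Reflecting the variable contributes `(-1)^N`, with `N` the order of differentiation, which
  -- cancels the sign in the right derivative.
  · rw [hI, iteratedDeriv_comp_neg, smul_eq_mul, hd.eq, ← mul_assoc,
      div_mul_eq_mul_div ((-1 : ℝ) ^ rlOrder α), ← mul_pow]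
    simp
  · refine hO.congr_left fun h => ?_
    simp only [leftDelta, rightDelta, harg]

end Grunwald

theorem theorem3p3 (α : ℝ) (hα : 0 < α) (r : ℝ) (p : ℕ) (hp : 1 ≤ p) :
    (∃ G : ℂ → ℂ, AnalyticAt ℂ G 0 ∧
      (∀ᶠ z in 𝓝 (0 : ℂ), 0 ≤ z.re → z ≠ 0 → G z = Grunwald.symbolG α r p z) ∧
      (fun z : ℂ => G z - 1) =O[𝓝 0] fun z : ℂ => z ^ p) ∧
    ∀ w : ℕ → ℝ, Grunwald.IsGeneratedBy w (Grunwald.genW α r p) →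
      ∀ m n : ℕ, (n : ℝ) - 1 < α → α ≤ (n : ℝ) → n < m → p ≤ m →
        ∀ f : ℝ → ℝ, ContDiff ℝ ((m + n + 1 : ℕ) : WithTop ℕ∞) f →
          (∀ k : ℕ, k ≤ m + n + 1 → Integrable (iteratedDeriv k f)) →
            ∀ x : ℝ, Grunwald.ApproximatesLeft w α r p f x ∧
              Grunwald.ApproximatesRight w α r p f x := by
  refine ⟨?_, ?_⟩
  · obtain ⟨G, hGan, hGO, hG⟩ := Grunwald.exists_analytic_symbol α hα r p hp
    refine ⟨G, hGan, ?_, hGO⟩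
    filter_upwards [hG] with z hz hre hz0
    have hzα : z ^ (α : ℂ) ≠ 0 := by simp [Complex.cpow_eq_zero_iff, hz0]
    rw [Grunwald.symbolG, mul_assoc, (hz hre hz0).2, one_div, inv_mul_cancel_left₀ hzα]
  · intro w hw m n hn hn' _ hpm
    have hleft : ∀ f : ℝ → ℝ, ContDiff ℝ ((m + n + 1 : ℕ) : WithTop ℕ∞) f →
        (∀ k : ℕ, k ≤ m + n + 1 → Integrable (iteratedDeriv k f)) →
          ∀ x : ℝ, Grunwald.ApproximatesLeft w α r p f x := by
      intro f hf hfi x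
      -- The case `α = n` is separate because neither frequency bound used for `α < n` survives
      -- there.
      rcases hn'.lt_or_eq with h | rfl
      · exact Grunwald.approximatesLeft_of_lt hα hp hw hn h hpm hf hfi x
      · refine Grunwald.approximatesLeft_natCast (by exact_mod_cast hα.ne') hp hw
          (hf.of_le (by exact_mod_cast (by omega : n + p ≤ m + n + 1))) ?_ x
        simpa using hfi 0 (Nat.zero_le _)
    intro f hf hfi x
    refine ⟨hleft f hf hfi x, Grunwald.approximatesRight_of_left_comp_neg
      (hleft (fun t => f (-t)) (hf.comp contDiff_neg) (fun k hk => ?_) (-x))⟩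
    have h1 : iteratedDeriv k (fun t => f (-t)) = fun t => (-1 : ℝ) ^ k • iteratedDeriv k f (-t) :=
      funext fun t => iteratedDeriv_comp_neg k f t
    rw [h1]
    exact (hfi k hk).comp_neg.const_mul ((-1 : ℝ) ^ k)
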